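/- Let $\mathcal{G}=(V,\mathcal{E})$ be a finite hypergraph (parallel hyperedges allowed, every hyperedge consisting of at least two vertices), let $h,k$ be positive integers, $K=\{1,\dots,k\}$ and $\ell:K\to\mathbb{Z}_{>0}$. There exists an $h$-regular packing of $k$ rooted hyperforests in $\mathcal{G}$ with $\ell(1),\dots,\ell(k)$ roots if and only if the following three conditions hold: $$|V|\ge \ell(i)\quad\text{for every } 1\le i\le k,$$ $$h|V|\ge \sum_{i=1}^k\ell(i),$$ $$\sum_{i=1}^k\min\{\ell(i),|\mathcal{P}|\}+e_{\mathcal{E}}(\mathcal{P})\ \ge\ h|\mathcal{P}|\quad\text{for every partition }\mathcal{P}\text{ of }V.$$ Here $e_{\mathcal{E}}(\mathcal{P})$ is the number of hyperedges in $\mathcal{E}$ that intersect some member of $\mathcal{P}$ without being contained in it. A digraph $(U,F)$ is an $S$-branching if $S\subseteq U$ and every $u\in U$ is reached by exactly one directed path starting in $S$ (paths may repeat vertices, so that $S$-branchings are exactly the vertex-disjoint unions of arborescences with one root at each $s\in S$). A directed hypergraph $\mathcal{B}=(U,\mathcal{F})$, in which every hyperarc has one head and at least one tail, is an $S$-hyperbranching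 if $S\subseteq U$ and each hyperarc can be replaced by an arc from one of its tails to its head such that the resulting arcs form an $S$-branching on the core of $\mathcal{B}$, which is the union of $S$ and the set of vertices of in-degree at least $1$ in $\mathcal{B}$. A hypergraph is an $S$-hyperforest (a rooted hyperforest with $|S|$ roots) if one can choose a head in each hyperedge, the other vertices becoming tails, such that an $S$-hyperbranching is obtained. A packing of $k$ rooted hyperforests in $\mathcal{G}$ is a family of $k$ pairwise hyperedge-disjoint subhypergraphs $\mathcal{T}_1,\dots,\mathcal{T}_k$ of $\mathcal{G}$, where $\mathcal{T}_i$ is an $S_i$-hyperforest; it is $h$-regular if each $\mathcal{T}_i$ can be oriented to an $S_i$-hyperbranching such that every vertex of $\mathcal{G}$ belongs to exactly $h$ of the $k$ cores. -/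

import Mathlib

/-- A finite directed multigraph: vertices are taken from `V`, arcs are labelled by `E`
(so parallel arcs are allowed). -/
structure MultiDigraph (V E : Type*) where
  verts : Finset V
  arcs : Finset E
  tail : E → V
  head : E → V
  tail_mem : ∀ a ∈ arcs, tail a ∈ verts
  head_mem : ∀ a ∈ arcs, head a ∈ verts

/-- A finite directed hypergraph (dypergraph), parallel hyperarcs allowed: a hyperarc has exactly
one head and at least one tail, and its head is not one of its tails. -/
structure Dypergraph (V E : Type*) where
  verts : Finset V
  hyperarcs : Finset E
  tails : E → Finset V
  head : E → V
  tails_subset : ∀ a ∈ hyperarcs, tails a ⊆ verts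
  head_mem : ∀ a ∈ hyperarcs, head a ∈ verts
  tails_nonempty : ∀ a ∈ hyperarcs, (tails a).Nonempty
  head_notMem_tails : ∀ a ∈ hyperarcs, head a ∉ tails a

/-- A finite hypergraph, parallel hyperedges allowed: the hyperedge labelled `e` is the vertex set
`ends e`, and it consists of at least two vertices. -/
structure MultiHypergraph (V E : Type*) where
  verts : Finset V
  edges : Finset E
  ends : E → Finset V
  ends_subset : ∀ e ∈ edges, ends e ⊆ verts
  two_le_card_ends : ∀ e ∈ edges, 2 ≤ (ends e).card

namespace MultiDigraph

variable {V E : Type*}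

/-- `D.IsDipath x l y`: the list of arcs `l` is a directed path of `D` from `x` to `y`
(consecutive arcs; the empty list is the trivial path from `x` to `x`). -/
def IsDipath (D : MultiDigraph V E) : V → List E → V → Prop
  | x, [], y => x = y
  | x, a :: l, y => a ∈ D.arcs ∧ D.tail a = x ∧ D.IsDipath (D.head a) l y

/-- `D` is a branching with root set `S`: `S` is a set of vertices of `D`, and every vertex `u` is
reached by exactly one directed path starting in `S`. As repeated vertices are not excluded from
paths a priori, uniqueness forces in-degree `0` on `S`, in-degree `1` elsewhere, and no directed
cycles. -/
def IsBranching (D : MultiDigraph V E) (S : Finset V) : Prop :=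
  S ⊆ D.verts ∧ ∀ u ∈ D.verts, ∃! p : V × List E, p.1 ∈ S ∧ D.IsDipath p.1 p.2 u

end MultiDigraph

namespace Dypergraph

variable {V E : Type*} [DecidableEq V]

/-- The number of hyperarcs entering `X`: head in `X`, at least one tail outside `X`. -/
def inDegree (D : Dypergraph V E) (X : Finset V) : ℕ :=
  (D.hyperarcs.filter fun a => D.head a ∈ X ∧ ¬ D.tails a ⊆ X).card

/-- The set of vertices of in-degree at least one, together with `S`. -/
def core (D : Dypergraph V E) (S : Finset V) : Finset V :=
  (D.verts.filter fun v => 1 ≤ D.inDegree {v}) ∪ S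

/-- The arcs of `A` are obtained by trimming the hyperarcs of `D`: each hyperarc is replaced by an
arc from one of its tails to its head. -/
def IsTrimming (D : Dypergraph V E) (A : MultiDigraph V E) : Prop :=
  A.arcs = D.hyperarcs ∧ ∀ a ∈ D.hyperarcs, A.head a = D.head a ∧ A.tail a ∈ D.tails a

/-- `D` is a hyperbranching with root set `S`: its hyperarcs can be trimmed to arcs that form, on
the core of `D`, a branching with root set `S`. -/
def IsHyperbranching (D : Dypergraph V E) (S : Finset V) : Prop :=
  S ⊆ D.verts ∧
    ∃ A : MultiDigraph V E, A.verts = D.core S ∧ D.IsTrimming A ∧ A.IsBranching S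

end Dypergraph

namespace MultiHypergraph

variable {V E : Type*} [DecidableEq V]

/-- `D` is obtained from `H` by choosing in each hyperedge a vertex to be its head; the other
vertices of the hyperedge become the tails. -/
def IsOrientation (H : MultiHypergraph V E) (D : Dypergraph V E) : Prop :=
  D.verts = H.verts ∧ D.hyperarcs = H.edges ∧
    ∀ e ∈ H.edges, D.head e ∈ H.ends e ∧ D.tails e = (H.ends e).erase (D.head e)

/-- `H` is a hyperforest with root set `S`. -/
def IsHyperforest (H : MultiHypergraph V E) (S : Finset V) : Prop :=
  ∃ D : Dypergraph V E, H.IsOrientation D ∧ D.IsHyperbranching S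

/-- `H` is a subhypergraph of `G`. -/
def IsSubhypergraph (H G : MultiHypergraph V E) : Prop :=
  H.verts ⊆ G.verts ∧ H.edges ⊆ G.edges ∧ ∀ e ∈ H.edges, H.ends e = G.ends e

/-- The number of hyperedges of `G` that enter some member of the partition `P`, where a hyperedge
enters `X` if it contains a vertex in `X` and a vertex outside `X`. -/
def numEntering (G : MultiHypergraph V E) (P : Finpartition G.verts) : ℕ :=
  (G.edges.filter fun e => ∃ X ∈ P.parts, (G.ends e ∩ X).Nonempty ∧ (G.ends e \ X).Nonempty).card

/-- `H 0, …, H (k-1)` is a packing in `G` of hyperforests with root sets `S 0, …, S (k-1)`: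
they are pairwise hyperedge-disjoint subhypergraphs of `G`. -/
def IsPacking (G : MultiHypergraph V E) {k : ℕ} (H : Fin k → MultiHypergraph V E)
    (S : Fin k → Finset V) : Prop :=
  (∀ i, (H i).IsSubhypergraph G ∧ (H i).IsHyperforest (S i)) ∧
    Pairwise fun i j => Disjoint (H i).edges (H j).edges

/-- The packing is `h`-regular: the hyperforests can be oriented to hyperbranchings (with the same
root sets) such that every vertex of `G` belongs to exactly `h` of their cores. -/
def IsRegularPacking (G : MultiHypergraph V E) (h : ℕ) {k : ℕ} (H : Fin k → MultiHypergraph V E)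
    (S : Fin k → Finset V) : Prop :=
  G.IsPacking H S ∧
    ∃ D : Fin k → Dypergraph V E,
      (∀ i, (H i).IsOrientation (D i) ∧ (D i).IsHyperbranching (S i)) ∧
      ∀ v ∈ G.verts, (Finset.univ.filter fun i => v ∈ (D i).core (S i)).card = h

end MultiHypergraph

/-! Necessity is a count. Fix a vertex in each class of the partition. Each of the `h` cores
containing it either has a root in the class or has a hyperedge whose head lies in the class and
which is not contained in it. Colours use disjoint hyperedges and a hyperedge has one head, so
summing over the classes gives the partition inequality (`IsRegularPacking.partition_le`).

For sufficiency, each minimum is expanded. Charging `|P|` to the colours in a set `J` and `ℓ i` to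
the others gives, with `p = h`, the family of inequalities `Covers`: the sum of `(p X - |J|)⁺` over
the classes is at most the number of crossing hyperedges plus the sum of `ℓ i` outside `J`. Allowing
any antitone supermodular `p` lets placed roots be recorded by lowering `p`. Partitions uncross
(`exists_excess_uncross`), so tight pairs are closed under meets (`Covers.tight_inf`). This drives
three minimality arguments: deleting hyperedges until `|F| + ∑ ℓ i = h |U|`, placing the roots
colour by colour, and trimming hyperedges to graph edges.

What remains is a graph with fixed root sets and a count condition `Sparse` on vertex sets. By
`Sparse.exists_exchange` some edge `uv` can be deleted while `v` becomes a new root of a colour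
rooted at `u`, preserving `Sparse`. By induction the smaller instance has a packing, and putting
back the arc `uv` hangs the arborescence at `v` below `u`. The vertex set of that branching, hence
regularity, is unchanged. -/

set_option linter.unusedSectionVars false

namespace MultiHypergraph

/-! ### Uncrossing partitions, represented by equivalence relations. -/

section Uncrossing

variable {V : Type*} [DecidableEq V]

open scoped Classical in
/-- The class of `v` in the partition of `U` induced by the equivalence relation `r`. -/
noncomputable def cls (U : Finset V) (r : Setoid V) (v : V) : Finset V :=
  U.filter fun w => r w v

/-- The partition of `U` induced by the equivalence relation `r`. -/
noncomputable def parts (U : Finset V) (r : Setoid V) : Finset (Finset V) :=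
  U.image (cls U r)

/-- The sum over the classes `X` of `r` of the positive part of `p X - c`. -/
noncomputable def excess (U : Finset V) (p : Finset V → ℤ) (c : ℤ) (r : Setoid V) : ℤ :=
  ∑ X ∈ parts U r, max (p X - c) 0

/-- Merge the classes of `x` and `y`. -/
def merge (r : Setoid V) (x y : V) : Setoid V where
  r u v := r u v ∨ ((r u x ∨ r u y) ∧ (r v x ∨ r v y))
  iseqv :=
    { refl := fun u => Or.inl (r.refl u)
      symm := by
        rintro u v (h | ⟨h1, h2⟩)
        · exact Or.inl (r.symm h)
        · exact Or.inr ⟨h2, h1⟩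
      trans := by
        rintro u v w (h | ⟨h1, h2⟩) (h' | ⟨h1', h2'⟩)
        · exact Or.inl (r.trans h h')
        · exact Or.inr ⟨h1'.imp (r.trans h) (r.trans h), h2'⟩
        · exact Or.inr ⟨h1, h2.imp (r.trans (r.symm h')) (r.trans (r.symm h'))⟩
        · exact Or.inr ⟨h1, h2'⟩ }

variable {U : Finset V} {r : Setoid V} {x y v w : V}

lemma mem_cls : w ∈ cls U r v ↔ w ∈ U ∧ r w v := by
  simp [cls]

lemma self_mem_cls (hv : v ∈ U) : v ∈ cls U r v :=
  mem_cls.2 ⟨hv, r.refl v⟩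

lemma cls_congr (h : r v w) : cls U r v = cls U r w := by
  ext u
  simp only [mem_cls]
  exact ⟨fun ⟨a, b⟩ => ⟨a, r.trans b h⟩, fun ⟨a, b⟩ => ⟨a, r.trans b (r.symm h)⟩⟩

lemma cls_mem_parts (hv : v ∈ U) : cls U r v ∈ parts U r :=
  Finset.mem_image_of_mem _ hv

lemma eq_cls_of_mem {X : Finset V} (hX : X ∈ parts U r) (hv : v ∈ X) : X = cls U r v := by
  obtain ⟨w, hw, rfl⟩ := Finset.mem_image.1 hX
  exact (cls_congr (mem_cls.1 hv).2).symm

lemma parts_congr {s : Setoid V} (h : ∀ x ∈ U, ∀ y ∈ U, r x y ↔ s x y) :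
    parts U r = parts U s := by
  refine Finset.image_congr fun v hv => ?_
  ext w
  simp only [mem_cls]
  exact and_congr_right fun hw => h w hw v hv

lemma cls_anti {s : Setoid V} (h : r ≤ s) : cls U r v ⊆ cls U s v := fun _ hw =>
  mem_cls.2 ⟨(mem_cls.1 hw).1, h (mem_cls.1 hw).2⟩

lemma merge_rel {u : V} :
    merge r x y u v ↔ r u v ∨ ((r u x ∨ r u y) ∧ (r v x ∨ r v y)) := Iff.rfl

lemma le_merge : r ≤ merge r x y := fun _ _ h => Or.inl h

lemma merge_self_rel : merge r x y x y := Or.inr ⟨Or.inl (r.refl x), Or.inr (r.refl y)⟩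

lemma merge_mono {s : Setoid V} (h : r ≤ s) : merge r x y ≤ merge s x y := by
  rintro u v (h1 | ⟨h1, h2⟩)
  · exact Or.inl (h h1)
  · exact Or.inr ⟨h1.imp (fun t => h t) (fun t => h t), h2.imp (fun t => h t) (fun t => h t)⟩

lemma merge_le {s : Setoid V} (h : r ≤ s) (hxy : s x y) : merge r x y ≤ s := by
  rintro u v (h1 | ⟨h1, h2⟩)
  · exact h h1
  · have a : s u x := h1.elim (fun t => h t) fun t => s.trans (h t) (s.symm hxy)
    have b : s v x := h2.elim (fun t => h t) fun t => s.trans (h t) (s.symm hxy)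
    exact s.trans a (s.symm b)

lemma merge_eq_self (hxy : r x y) : merge r x y = r :=
  le_antisymm (merge_le le_rfl hxy) le_merge

lemma disjoint_cls (hxy : ¬ r x y) : Disjoint (cls U r x) (cls U r y) :=
  Finset.disjoint_left.2 fun _ h1 h2 =>
    hxy (r.trans (r.symm (mem_cls.1 h1).2) (mem_cls.1 h2).2)

lemma parts_merge (hx : x ∈ U) :
    parts U (merge r x y) =
      insert (cls U r x ∪ cls U r y) (((parts U r).erase (cls U r x)).erase (cls U r y)) := by
  have h1 : ∀ v, (r v x ∨ r v y) → cls U (merge r x y) v = cls U r x ∪ cls U r y := by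
    intro v hv
    ext w
    simp only [mem_cls, Finset.mem_union, merge_rel]
    constructor
    · rintro ⟨hw, h | ⟨h, -⟩⟩
      · exact hv.imp (fun t => ⟨hw, r.trans h t⟩) (fun t => ⟨hw, r.trans h t⟩)
      · exact h.imp (fun t => ⟨hw, t⟩) (fun t => ⟨hw, t⟩)
    · rintro (⟨hw, h⟩ | ⟨hw, h⟩)
      · exact ⟨hw, Or.inr ⟨Or.inl h, hv⟩⟩
      · exact ⟨hw, Or.inr ⟨Or.inr h, hv⟩⟩
  have h2 : ∀ v, ¬ (r v x ∨ r v y) → cls U (merge r x y) v = cls U r v := by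
    intro v hv
    ext w
    simp only [mem_cls, merge_rel]
    constructor
    · rintro ⟨hw, h | ⟨-, h⟩⟩
      · exact ⟨hw, h⟩
      · exact absurd h hv
    · rintro ⟨hw, h⟩
      exact ⟨hw, Or.inl h⟩
  ext X
  simp only [Finset.mem_insert, Finset.mem_erase]
  constructor
  · intro hX
    obtain ⟨v, hv, rfl⟩ := Finset.mem_image.1 hX
    by_cases hr : r v x ∨ r v y
    · exact Or.inl (h1 v hr)
    · rw [h2 v hr]
      refine Or.inr ⟨?_, ?_, cls_mem_parts hv⟩
      · intro h
        exact hr (Or.inr (mem_cls.1 (h ▸ self_mem_cls hv)).2)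
      · intro h
        exact hr (Or.inl (mem_cls.1 (h ▸ self_mem_cls hv)).2)
  · rintro (rfl | ⟨hy', hx', hX⟩)
    · rw [← h1 x (Or.inl (r.refl x))]
      exact cls_mem_parts hx
    · obtain ⟨v, hv, rfl⟩ := Finset.mem_image.1 hX
      have hr : ¬ (r v x ∨ r v y) := by
        rintro (h | h)
        · exact hx' (cls_congr h)
        · exact hy' (cls_congr h)
      rw [← h2 v hr]
      exact cls_mem_parts hv

lemma excess_merge (hx : x ∈ U) (hy : y ∈ U) (hxy : ¬ r x y) (p : Finset V → ℤ) (c : ℤ) :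
    excess U p c (merge r x y) = excess U p c r - max (p (cls U r x) - c) 0
      - max (p (cls U r y) - c) 0 + max (p (cls U r x ∪ cls U r y) - c) 0 := by
  unfold excess
  rw [parts_merge hx, Finset.sum_insert, Finset.sum_erase_eq_sub, Finset.sum_erase_eq_sub]
  · ring
  · exact cls_mem_parts hx
  · refine Finset.mem_erase.2 ⟨fun h => hxy ?_, cls_mem_parts hy⟩
    exact (mem_cls.1 (h.symm ▸ self_mem_cls hx : x ∈ cls U r y)).2
  · intro h
    have h' := (Finset.mem_erase.1 (Finset.mem_erase.1 h).2).2
    have e := eq_cls_of_mem h' (Finset.mem_union_left _ (self_mem_cls hx))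
    have : y ∈ cls U r x := e ▸ Finset.mem_union_right _ (self_mem_cls hy)
    exact hxy (r.symm (mem_cls.1 this).2)

/-- Antitone supermodular set functions. -/
structure IsDemand (p : Finset V → ℤ) : Prop where
  anti : ∀ X Y, X ⊆ Y → p Y ≤ p X
  super : ∀ X Y, p X + p Y ≤ p (X ∩ Y) + p (X ∪ Y)

/-- Diminishing losses: a merger costs less excess in a coarser partition with a larger threshold.
Supermodularity, applied twice to enlarge one class at a time, compares the two losses of `p`;
antitonicity controls the positive parts. -/
lemma excess_sub_merge_le {p : Finset V → ℤ} (hp : IsDemand p) {c c' : ℤ} (hc : c ≤ c')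
    {P Q : Setoid V} (hQP : Q ≤ P) (hx : x ∈ U) (hy : y ∈ U) :
    excess U p c' P - excess U p c' (merge P x y) ≤
      excess U p c Q - excess U p c (merge Q x y) := by
  by_cases hQ : Q x y
  · rw [merge_eq_self hQ, merge_eq_self (hQP hQ)]
    simp
  rw [excess_merge hx hy hQ]
  have d1 := hp.anti (cls U Q x) (cls U Q x ∪ cls U Q y) Finset.subset_union_left
  have d2 := hp.anti (cls U Q y) (cls U Q x ∪ cls U Q y) Finset.subset_union_right
  by_cases hP : P x y
  · rw [merge_eq_self hP]
    omega
  rw [excess_merge hx hy hP]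
  have sx : cls U Q x ⊆ cls U P x := cls_anti hQP
  have sy : cls U Q y ⊆ cls U P y := cls_anti hQP
  have d3 := hp.anti (cls U P x) (cls U P x ∪ cls U P y) Finset.subset_union_left
  have d4 := hp.anti (cls U P y) (cls U P x ∪ cls U P y) Finset.subset_union_right
  have d5 := hp.anti _ _ sx
  have d6 := hp.anti _ _ sy
  have d7 := hp.anti _ _ (Finset.union_subset_union sx sy)
  have hd := Finset.disjoint_left.1 (disjoint_cls (U := U) hP)
  have s1 := hp.super (cls U P x) (cls U Q x ∪ cls U Q y)
  have s2 := hp.super (cls U P x ∪ cls U Q y) (cls U P y)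
  have e1 : cls U P x ∩ (cls U Q x ∪ cls U Q y) = cls U Q x := by
    ext w
    have := @sx w; have := @sy w; have := @hd w
    simp only [Finset.mem_inter, Finset.mem_union]
    tauto
  have e2 : cls U P x ∪ (cls U Q x ∪ cls U Q y) = cls U P x ∪ cls U Q y := by
    ext w
    have := @sx w
    simp only [Finset.mem_union]
    tauto
  have e3 : (cls U P x ∪ cls U Q y) ∩ cls U P y = cls U Q y := by
    ext w
    have := @sx w; have := @sy w; have := @hd w
    simp only [Finset.mem_inter, Finset.mem_union]
    tauto
  have e4 : cls U P x ∪ cls U Q y ∪ cls U P y = cls U P x ∪ cls U P y := by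
    ext w
    have := @sy w
    simp only [Finset.mem_union]
    tauto
  rw [e1, e2] at s1
  rw [e3, e4] at s2
  omega

/-- Merge the classes of all pairs in a list. -/
def mergeList (r : Setoid V) (L : List (V × V)) : Setoid V :=
  L.foldl (fun r e => merge r e.1 e.2) r

lemma le_mergeList (L : List (V × V)) (r : Setoid V) : r ≤ mergeList r L := by
  induction L generalizing r with
  | nil => exact le_rfl
  | cons e L ih => exact le_merge.trans (ih (merge r e.1 e.2))

lemma mergeList_rel (L : List (V × V)) (r : Setoid V) {e : V × V} (he : e ∈ L) :
    mergeList r L e.1 e.2 := by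
  induction L generalizing r with
  | nil => simp at he
  | cons f L ih =>
    rcases List.mem_cons.1 he with rfl | he
    · exact le_mergeList L (merge r e.1 e.2) merge_self_rel
    · exact ih _ he

lemma mergeList_le (L : List (V × V)) {r s : Setoid V} (h : r ≤ s)
    (hL : ∀ e ∈ L, s e.1 e.2) : mergeList r L ≤ s := by
  induction L generalizing r with
  | nil => exact h
  | cons f L ih =>
    exact ih (merge_le h (hL f (by simp))) fun e he => hL e (by simp [he])

lemma excess_sub_mergeList_le {p : Finset V → ℤ} (hp : IsDemand p) {c c' : ℤ} (hc : c ≤ c')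
    (L : List (V × V)) (hL : ∀ e ∈ L, e.1 ∈ U ∧ e.2 ∈ U) {P Q : Setoid V} (hQP : Q ≤ P) :
    excess U p c' P - excess U p c' (mergeList P L) ≤
      excess U p c Q - excess U p c (mergeList Q L) := by
  induction L generalizing P Q with
  | nil => simp [mergeList]
  | cons f L ih =>
    have h1 := excess_sub_merge_le hp hc hQP (hL f (by simp)).1 (hL f (by simp)).2
    have h2 := ih (fun e he => hL e (by simp [he])) (merge_mono (x := f.1) (y := f.2) hQP)
    simp only [mergeList, List.foldl_cons] at h2 ⊢
    linarith

/-- Uncrossing of two partitions. -/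
lemma exists_excess_uncross {p : Finset V → ℤ} (hp : IsDemand p) {c c' : ℤ} (hc : c ≤ c')
    (U : Finset V) (P P' : Setoid V) :
    ∃ J : Setoid V, P ≤ J ∧ (∀ x ∈ U, ∀ y ∈ U, P' x y → J x y) ∧
      excess U p c' P + excess U p c P' ≤ excess U p c (P ⊓ P') + excess U p c' J := by
  classical
  -- One list of mergers serves twice: on `U` it turns `P` into the join and `P ⊓ P'` into `P'`.
  let L := ((U ×ˢ U).filter fun e => P' e.1 e.2).toList
  have hL : ∀ e, e ∈ L ↔ (e.1 ∈ U ∧ e.2 ∈ U) ∧ P' e.1 e.2 := by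
    intro e
    simp [L]
  refine ⟨mergeList P L, le_mergeList L P, fun x hx y hy hxy => ?_, ?_⟩
  · exact mergeList_rel L P ((hL (x, y)).2 ⟨⟨hx, hy⟩, hxy⟩)
  · have h1 := excess_sub_mergeList_le hp hc L (fun e he => ((hL e).1 he).1)
      (inf_le_left : P ⊓ P' ≤ P)
    have h2 : excess U p c (mergeList (P ⊓ P') L) = excess U p c P' := by
      unfold excess
      rw [parts_congr (s := P')]
      intro x hx y hy
      exact ⟨fun h => mergeList_le L inf_le_right (fun e he => ((hL e).1 he).2) h,
        fun h => mergeList_rel L _ ((hL (x, y)).2 ⟨⟨hx, hy⟩, h⟩)⟩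
    linarith

end Uncrossing

/-! ### The covering condition and its tight pairs. -/

section Covering

variable {V E K : Type*} [DecidableEq V] [DecidableEq E] [DecidableEq K]

/-- `X` meets at least two classes of `r`. -/
def Crosses (r : Setoid V) (X : Finset V) : Prop := ∃ x ∈ X, ∃ y ∈ X, ¬ r x y

open scoped Classical in
/-- The number of hyperedges meeting at least two classes of `r`. -/
noncomputable def crossing (F : Finset E) (A : E → Finset V) (r : Setoid V) : ℕ :=
  (F.filter fun e => Crosses r (A e)).card

variable {U : Finset V} {F : Finset E} {A : E → Finset V} {p : Finset V → ℤ} {ℓ : K → ℕ}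
  {T : Finset K}

lemma Crosses.inf_left {P P' : Setoid V} {X : Finset V} (h : Crosses P X) :
    Crosses (P ⊓ P') X := by
  obtain ⟨x, hx, y, hy, hxy⟩ := h
  exact ⟨x, hx, y, hy, fun t => hxy t.1⟩

lemma Crosses.inf_right {P P' : Setoid V} {X : Finset V} (h : Crosses P' X) :
    Crosses (P ⊓ P') X := by
  obtain ⟨x, hx, y, hy, hxy⟩ := h
  exact ⟨x, hx, y, hy, fun t => hxy t.2⟩

lemma crosses_inf {P P' : Setoid V} {X : Finset V} :
    Crosses (P ⊓ P') X → Crosses P X ∨ Crosses P' X := by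
  rintro ⟨x, hx, y, hy, hxy⟩
  by_cases h : P x y
  · exact Or.inr ⟨x, hx, y, hy, fun t => hxy ⟨h, t⟩⟩
  · exact Or.inl ⟨x, hx, y, hy, h⟩

lemma Crosses.of_le {P N : Setoid V} {X : Finset V} (hX : X ⊆ U)
    (hPN : ∀ x ∈ U, ∀ y ∈ U, P x y → N x y) (h : Crosses N X) : Crosses P X := by
  obtain ⟨x, hx, y, hy, hxy⟩ := h
  exact ⟨x, hx, y, hy, fun t => hxy (hPN x (hX hx) y (hX hy) t)⟩

/-- The inequality holds hyperedge by hyperedge: crossing the meet means crossing one of the two,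
and crossing `N` means crossing both. It is strict at a hyperedge that crosses `P` and `P'` but not
`N`, which gives the second claim. -/
lemma crossing_uncross (hA : ∀ e ∈ F, A e ⊆ U) {P P' N : Setoid V}
    (hP : ∀ x ∈ U, ∀ y ∈ U, P x y → N x y) (hP' : ∀ x ∈ U, ∀ y ∈ U, P' x y → N x y) :
    crossing F A (P ⊓ P') + crossing F A N ≤ crossing F A P + crossing F A P' ∧
      (crossing F A P + crossing F A P' ≤ crossing F A (P ⊓ P') + crossing F A N →
        ∀ e ∈ F, Crosses P (A e) → Crosses P' (A e) → Crosses N (A e)) := by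
  classical
  unfold crossing
  simp only [Finset.card_filter, ← Finset.sum_add_distrib]
  have key : ∀ e ∈ F, ((if Crosses (P ⊓ P') (A e) then 1 else 0) +
      (if Crosses N (A e) then 1 else 0) : ℕ) ≤
      (if Crosses P (A e) then 1 else 0) + (if Crosses P' (A e) then 1 else 0) := by
    intro e he
    have h1 := @Crosses.of_le V _ U P N (A e) (hA e he) hP
    have h2 := @Crosses.of_le V _ U P' N (A e) (hA e he) hP'
    have h3 := @crosses_inf V _ P P' (A e)
    split_ifs <;> first | omega | tauto
  refine ⟨Finset.sum_le_sum key, fun hle e he c1 c2 => ?_⟩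
  by_contra c3
  refine absurd hle (not_le.2 (Finset.sum_lt_sum key ⟨e, he, ?_⟩))
  rw [if_pos c1, if_pos c2, if_neg c3]
  split_ifs <;> omega

/-- The partition condition when the root sets of the colours in `T` are still to be placed. -/
def Covers (U : Finset V) (F : Finset E) (A : E → Finset V) (p : Finset V → ℤ) (ℓ : K → ℕ)
    (T : Finset K) : Prop :=
  ∀ J ⊆ T, ∀ r : Setoid V, excess U p J.card r ≤ crossing F A r + ∑ i ∈ T \ J, (ℓ i : ℤ)

/-- The partition condition holds with equality. -/
def Tight (U : Finset V) (F : Finset E) (A : E → Finset V) (p : Finset V → ℤ) (ℓ : K → ℕ)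
    (T J : Finset K) (r : Setoid V) : Prop :=
  J ⊆ T ∧ excess U p J.card r = crossing F A r + ∑ i ∈ T \ J, (ℓ i : ℤ)

/-- The engine of the minimality arguments. Blocking pairs can be combined into one by meets; the
bounds on `M.card` are needed for placing roots, the coarser partition `N` for trimming. -/
lemma Covers.tight_inf (hp : IsDemand p) (hA : ∀ e ∈ F, A e ⊆ U) (hC : Covers U F A p ℓ T)
    {J J' : Finset K} {P P' : Setoid V} (h : Tight U F A p ℓ T J P)
    (h' : Tight U F A p ℓ T J' P') :
    ∃ M, Tight U F A p ℓ T M (P ⊓ P') ∧ M.card ≤ J.card ∧ M.card ≤ J'.card ∧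
      ∃ N : Setoid V, (∀ x ∈ U, ∀ y ∈ U, P x y → N x y) ∧ (∀ x ∈ U, ∀ y ∈ U, P' x y → N x y) ∧
        ∀ e ∈ F, Crosses P (A e) → Crosses P' (A e) → Crosses N (A e) := by
  wlog hJ : J'.card ≤ J.card generalizing J J' P P'
  · obtain ⟨M, h1, h2, h3, N, h4, h5, h6⟩ := this h' h (le_of_not_ge hJ)
    exact ⟨M, inf_comm P P' ▸ h1, h3, h2, N, h5, h4, fun e he a b => h6 e he b a⟩
  obtain ⟨N, hN, hN', hex⟩ := exists_excess_uncross hp (Nat.cast_le.2 hJ) U P P'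
  have hN0 : ∀ x ∈ U, ∀ y ∈ U, P x y → N x y := fun x _ y _ t => hN t
  obtain ⟨c1, c2⟩ := crossing_uncross hA hN0 hN'
  -- The smaller set goes with the meet and the larger with the join, so the root terms cancel and
  -- equality holds throughout.
  have h1 := hC J' h'.1 (P ⊓ P')
  have h2 := hC J h.1 N
  have h3 := h.2
  have h4 := h'.2
  refine ⟨J', ⟨h'.1, ?_⟩, hJ, le_rfl, N, hN0, hN', c2 ?_⟩ <;> omega

end Covering

/-! ### Deleting and trimming hyperedges. -/

section Reductions

variable {V E K : Type*} [DecidableEq V] [DecidableEq E] [DecidableEq K]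
  {U : Finset V} {F : Finset E} {A : E → Finset V} {p : Finset V → ℤ} {ℓ : K → ℕ}
  {T : Finset K}

lemma Covers.exists_tight_of_not_erase (hC : Covers U F A p ℓ T) {e : E} (he : e ∈ F)
    (h : ¬ Covers U (F.erase e) A p ℓ T) :
    ∃ J r, Tight U F A p ℓ T J r ∧ Crosses r (A e) := by
  classical
  unfold Covers at h
  push Not at h
  obtain ⟨J, hJ, r, hr⟩ := h
  have h1 := hC J hJ r
  by_cases hc : Crosses r (A e)
  · refine ⟨J, r, ⟨hJ, ?_⟩, hc⟩
    have : crossing (F.erase e) A r + 1 = crossing F A r := by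
      unfold crossing
      rw [Finset.filter_erase, Finset.card_erase_add_one]
      exact Finset.mem_filter.2 ⟨he, hc⟩
    omega
  · have : crossing (F.erase e) A r = crossing F A r := by
      unfold crossing
      rw [Finset.filter_erase, Finset.erase_eq_of_notMem]
      simp [hc]
    omega

lemma card_parts_le (r : Setoid V) : (parts U r).card ≤ U.card := Finset.card_image_le

lemma card_parts_bot : (parts U (⊥ : Setoid V)).card = U.card := by
  refine Finset.card_image_of_injOn fun x hx y hy h => ?_
  have : x ∈ cls U (⊥ : Setoid V) y := by
    have h' : cls U (⊥ : Setoid V) x = cls U ⊥ y := h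
    exact h' ▸ self_mem_cls hx
  exact (mem_cls.1 this).2

lemma isDemand_const (c : ℤ) : IsDemand fun _ : Finset V => c :=
  ⟨fun _ _ _ => le_rfl, fun _ _ => le_rfl⟩

lemma excess_const (h c : ℤ) (r : Setoid V) :
    excess U (fun _ => h) c r = (parts U r).card * max (h - c) 0 := by
  simp [excess]

/-- Superfluous hyperedges can be deleted. -/
lemma exists_subset_covers_card_eq [Fintype K] (h : ℕ) (hA : ∀ e ∈ F, A e ⊆ U)
    (hn : ∀ i, ℓ i ≤ U.card) (hs : ∑ i, ℓ i ≤ h * U.card)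
    (hC : Covers U F A (fun _ => (h : ℤ)) ℓ Finset.univ) :
    ∃ F' ⊆ F, Covers U F' A (fun _ => (h : ℤ)) ℓ Finset.univ ∧
      F'.card + ∑ i, ℓ i = h * U.card := by
  classical
  obtain ⟨F', hF', hmin⟩ := Finset.exists_min_image
    (F.powerset.filter fun F' => Covers U F' A (fun _ => (h : ℤ)) ℓ Finset.univ) Finset.card
    ⟨F, by simp [hC]⟩
  simp only [Finset.mem_filter, Finset.mem_powerset] at hF' hmin
  obtain ⟨hsub, hC'⟩ := hF'
  have hp := isDemand_const (V := V) (h : ℤ)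
  have hA' : ∀ e ∈ F', A e ⊆ U := fun e he => hA e (hsub he)
  refine ⟨F', hsub, hC', le_antisymm ?_ ?_⟩
  · rcases F'.eq_empty_or_nonempty with rfl | hne
    · simpa using hs
    have hbl : ∀ e ∈ F', ∃ J r, Tight U F' A (fun _ => (h : ℤ)) ℓ Finset.univ J r ∧
        Crosses r (A e) := by
      intro e he
      refine hC'.exists_tight_of_not_erase he fun hcov => ?_
      have := hmin (F'.erase e) ⟨(Finset.erase_subset _ _).trans hsub, hcov⟩
      exact absurd (Finset.card_erase_lt_of_mem he) (not_lt.2 this)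
    -- Meeting the blocking pairs leads to one tight pair whose partition every hyperedge of `F'`
    -- crosses. `D` is nonempty because without hyperedges there need be no tight pair.
    have hall : ∀ D ⊆ F', D.Nonempty →
        ∃ J r, Tight U F' A (fun _ => (h : ℤ)) ℓ Finset.univ J r ∧
          ∀ e ∈ D, Crosses r (A e) := by
      intro D hD hDne
      induction hDne using Finset.Nonempty.cons_induction with
      | singleton e =>
        obtain ⟨J, r, h1, h2⟩ := hbl e (hD (by simp))
        exact ⟨J, r, h1, by simpa using h2⟩
      | cons e D he hDne ih =>
        obtain ⟨J, r, h1, h2⟩ := hbl e (hD (by simp))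
        obtain ⟨J', r', h1', h2'⟩ := ih fun x hx => hD (by simp [hx])
        obtain ⟨M, hM, -⟩ := hC'.tight_inf hp hA' h1 h1'
        refine ⟨M, _, hM, fun x hx => ?_⟩
        rcases Finset.mem_cons.1 hx with rfl | hx
        · exact h2.inf_left
        · exact (h2' x hx).inf_right
    obtain ⟨J, r, ⟨-, ht⟩, hcr⟩ := hall F' subset_rfl hne
    have hcard : crossing F' A r = F'.card := by
      unfold crossing
      rw [Finset.filter_true_of_mem hcr]
    rw [excess_const, hcard] at ht
    have hpos : 0 < F'.card := hne.card_pos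
    have hsum0 : (0 : ℤ) ≤ ∑ i ∈ Finset.univ \ J, (ℓ i : ℤ) :=
      Finset.sum_nonneg fun i _ => by positivity
    -- Otherwise the excess is `0`, while the right side is at least `F'.card > 0`.
    have hlt : (J.card : ℤ) < h := by
      by_contra hcon
      rw [max_eq_right (by omega)] at ht
      omega
    rw [max_eq_left (by omega)] at ht
    have hle : ((parts U r).card : ℤ) * (h - J.card) ≤ U.card * (h - J.card) :=
      mul_le_mul_of_nonneg_right (by exact_mod_cast card_parts_le r) (by omega)
    have hJ : ∑ i ∈ J, (ℓ i : ℤ) ≤ J.card * U.card := by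
      have := Finset.sum_le_card_nsmul J (fun i => (ℓ i : ℤ)) U.card
        fun i _ => by exact_mod_cast hn i
      simpa using this
    have hsplit := Finset.sum_sdiff (Finset.subset_univ J) (f := fun i => (ℓ i : ℤ))
    have : (F'.card : ℤ) + ∑ i, (ℓ i : ℤ) ≤ h * U.card := by
      rw [← hsplit]
      nlinarith
    exact_mod_cast this
  -- The reverse inequality is the condition for singletons with `J = ∅`.
  · have h1 := hC' ∅ (Finset.empty_subset _) ⊥
    rw [excess_const, card_parts_bot] at h1
    have h2 : crossing F' A ⊥ ≤ F'.card := Finset.card_filter_le _ _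
    have h3 : (U.card : ℤ) * h ≤ F'.card + ∑ i, (ℓ i : ℤ) := by
      simp at h1
      have : (crossing F' A ⊥ : ℤ) ≤ F'.card := by exact_mod_cast h2
      linarith
    have h4 : U.card * h ≤ F'.card + ∑ i, ℓ i := by exact_mod_cast h3
    linarith [mul_comm h U.card]

lemma Covers.exists_tight_of_not_trim (hC : Covers U F A p ℓ T) {e : E} (he : e ∈ F) {B : Finset V}
    (h : ¬ Covers U F (Function.update A e B) p ℓ T) :
    ∃ J r, Tight U F A p ℓ T J r ∧ Crosses r (A e) ∧ ¬ Crosses r B := by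
  classical
  unfold Covers at h
  push Not at h
  obtain ⟨J, hJ, r, hr⟩ := h
  have h1 := hC J hJ r
  have h2 : ∀ C : Finset V, crossing F (Function.update A e C) r =
      crossing (F.erase e) A r + if Crosses r C then 1 else 0 := by
    intro C
    unfold crossing
    simp only [Finset.card_filter]
    rw [← Finset.sum_erase_add _ _ he, Function.update_self]
    congr 1
    refine Finset.sum_congr rfl fun x hx => ?_
    rw [Function.update_of_ne (Finset.ne_of_mem_erase hx)]
  have h3 := h2 B
  have h4 := h2 (A e)
  rw [Function.update_eq_self] at h4
  split_ifs at h3 h4 with c1 c2 c2 <;> first | omega | exact ⟨J, r, ⟨hJ, by omega⟩, c2, c1⟩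

/-- Hyperedges can be trimmed to edges. -/
lemma Covers.exists_trimming (hp : IsDemand p) (hA : ∀ e ∈ F, A e ⊆ U)
    (h2 : ∀ e ∈ F, 2 ≤ (A e).card) (hC : Covers U F A p ℓ T) :
    ∃ B : E → Finset V, (∀ e ∈ F, B e ⊆ A e) ∧ (∀ e ∈ F, (B e).card = 2) ∧
      Covers U F B p ℓ T := by
  classical
  induction hm : ∑ e ∈ F, (A e).card using Nat.strong_induction_on generalizing A with
  | _ m ih =>
  by_cases hall : ∀ e ∈ F, (A e).card = 2
  · exact ⟨A, fun _ _ => subset_rfl, hall, hC⟩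
  push Not at hall
  obtain ⟨e, he, hne⟩ := hall
  have h3 : 2 < (A e).card := lt_of_le_of_ne (h2 e he) (Ne.symm hne)
  have step : ∀ u ∈ A e, Covers U F (Function.update A e ((A e).erase u)) p ℓ T →
      ∃ B : E → Finset V, (∀ e ∈ F, B e ⊆ A e) ∧ (∀ e ∈ F, (B e).card = 2) ∧
        Covers U F B p ℓ T := by
    intro u hu hcov
    have hsub : ∀ x, Function.update A e ((A e).erase u) x ⊆ A x := by
      intro x
      by_cases hx : x = e
      · subst hx
        rw [Function.update_self]
        exact Finset.erase_subset _ _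
      · rw [Function.update_of_ne hx]
    have hc := Finset.card_erase_of_mem hu
    obtain ⟨B, hB1, hB2, hB3⟩ := ih (∑ x ∈ F, (Function.update A e ((A e).erase u) x).card)
      (by
        rw [← hm]
        refine Finset.sum_lt_sum (fun x _ => Finset.card_le_card (hsub x)) ⟨e, he, ?_⟩
        rw [Function.update_self]
        omega)
      (fun x hx => (hsub x).trans (hA x hx))
      (fun x hx => by
        by_cases hxe : x = e
        · subst hxe
          rw [Function.update_self]
          omega
        · rw [Function.update_of_ne hxe]
          exact h2 x hx) hcov rfl
    exact ⟨B, fun x hx => (hB1 x hx).trans (hsub x), hB2, hB3⟩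
  obtain ⟨u, v, w, hu, hv, hw, huv, huw, hvw⟩ := Finset.two_lt_card_iff.1 h3
  by_cases cu : Covers U F (Function.update A e ((A e).erase u)) p ℓ T
  · exact step u hu cu
  by_cases cv : Covers U F (Function.update A e ((A e).erase v)) p ℓ T
  · exact step v hv cv
  -- If neither `u` nor `v` can be dropped, `A e` without `u` lies in one class of `r`, and `A e`
  -- without `v` in one class of `r'`. The third vertex `w` links the two, so `A e` lies in one
  -- class of `N`, although tightness forces it to cross `N`.
  obtain ⟨J, r, t1, t2, t3⟩ := hC.exists_tight_of_not_trim he cu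
  obtain ⟨J', r', t1', t2', t3'⟩ := hC.exists_tight_of_not_trim he cv
  obtain ⟨-, -, -, -, N, n1, n2, n3⟩ := hC.tight_inf hp hA t1 t1'
  exfalso
  obtain ⟨x, hx, y, hy, hxy⟩ := n3 e he t2 t2'
  have hw' : ∀ x ∈ A e, N x w := by
    intro x hx
    by_cases hxu : x = u
    · refine n2 x (hA e he hx) w (hA e he hw) (by_contra fun hn => t3' ⟨x, ?_, w, ?_, hn⟩)
      · exact Finset.mem_erase.2 ⟨by rw [hxu]; exact huv, hx⟩
      · exact Finset.mem_erase.2 ⟨hvw.symm, hw⟩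
    · refine n1 x (hA e he hx) w (hA e he hw) (by_contra fun hn => t3 ⟨x, ?_, w, ?_, hn⟩)
      · exact Finset.mem_erase.2 ⟨hxu, hx⟩
      · exact Finset.mem_erase.2 ⟨huw.symm, hw⟩
  exact hxy (N.trans (hw' x hx) (N.symm (hw' y hy)))

end Reductions

/-! ### Placing the roots. -/

section Placement

variable {V E K : Type*} [DecidableEq V] [DecidableEq E] [DecidableEq K]
  {U : Finset V} {F : Finset E} {A : E → Finset V} {p : Finset V → ℤ} {ℓ : K → ℕ}
  {T : Finset K}

/-- The indicator of `X` meeting `S`. -/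
def hit (S X : Finset V) : ℤ := if (S ∩ X).Nonempty then 1 else 0

lemma hit_mono {S S' X X' : Finset V} (hS : S ⊆ S') (hX : X ⊆ X') : hit S X ≤ hit S' X' := by
  unfold hit
  have := Finset.Nonempty.mono (Finset.inter_subset_inter hS hX)
  split_ifs <;> first | omega | tauto

lemma hit_union_add_inter_le (S X Y : Finset V) :
    hit S (X ∩ Y) + hit S (X ∪ Y) ≤ hit S X + hit S Y := by
  have h1 := hit_mono (subset_refl S) (Finset.inter_subset_left : X ∩ Y ⊆ X)
  have h2 := hit_mono (subset_refl S) (Finset.inter_subset_right : X ∩ Y ⊆ Y)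
  have h3 : (S ∩ (X ∪ Y)).Nonempty → (S ∩ X).Nonempty ∨ (S ∩ Y).Nonempty := by
    rw [Finset.inter_union_distrib_left, Finset.union_nonempty]
    exact id
  unfold hit at *
  split_ifs at * <;> first | omega | tauto

lemma IsDemand.sub_hit (hp : IsDemand p) (S : Finset V) : IsDemand fun X => p X - hit S X where
  anti X Y h := by
    have := hp.anti X Y h
    have := hit_mono (subset_refl S) h
    omega
  super X Y := by
    have := hp.super X Y
    have := hit_union_add_inter_le S X Y
    omega

lemma excess_mono {p q : Finset V → ℤ} {c d : ℤ} {r : Setoid V}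
    (h : ∀ X ∈ parts U r, p X - c ≤ q X - d) : excess U p c r ≤ excess U q d r :=
  Finset.sum_le_sum fun X hX => max_le_max (h X hX) le_rfl

lemma hit_eq_one_of_mem {S X : Finset V} {v : V} (h1 : v ∈ S) (h2 : v ∈ X) : hit S X = 1 :=
  if_pos ⟨v, Finset.mem_inter.2 ⟨h1, h2⟩⟩

lemma hit_erase_of_notMem {S X : Finset V} {v : V} (h : v ∉ X) :
    hit (S.erase v) X = hit S X := by
  unfold hit
  rw [Finset.erase_inter, Finset.erase_eq_of_notMem fun h' => h (Finset.mem_inter.1 h').2]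

/-- Unplacing `v` changes the excess only at the class of `v`, and by at most one. A violation
therefore needs tightness, `v` as the only root in its class, and a positive part that really grows.
-/
lemma Covers.exists_tight_of_not_unplace {S : Finset V} {v : V} (hv : v ∈ U)
    (hC : Covers U F A (fun X => p X - hit S X) ℓ T)
    (h : ¬ Covers U F A (fun X => p X - hit (S.erase v) X) ℓ T) :
    ∃ J r, Tight U F A (fun X => p X - hit S X) ℓ T J r ∧
      S ∩ cls U r v ⊆ {v} ∧ (J.card : ℤ) ≤ p (cls U r v) - hit S (cls U r v) := by
  unfold Covers at h
  push Not at h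
  obtain ⟨J, hJ, r, hr⟩ := h
  have h1 := hC J hJ r
  have hsplit : ∀ q : Finset V → ℤ, excess U q J.card r =
      ∑ X ∈ (parts U r).erase (cls U r v), max (q X - J.card) 0 +
        max (q (cls U r v) - J.card) 0 := fun q =>
    (Finset.sum_erase_add _ _ (cls_mem_parts hv)).symm
  have heq : ∑ X ∈ (parts U r).erase (cls U r v), max (p X - hit (S.erase v) X - J.card) 0 =
      ∑ X ∈ (parts U r).erase (cls U r v), max (p X - hit S X - J.card) 0 := by
    refine Finset.sum_congr rfl fun X hX => ?_
    rw [hit_erase_of_notMem]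
    intro hvX
    exact (Finset.mem_erase.1 hX).1 (eq_cls_of_mem (Finset.mem_erase.1 hX).2 hvX)
  have e1 := hsplit fun X => p X - hit S X
  have e2 := hsplit fun X => p X - hit (S.erase v) X
  rw [heq] at e2
  have hlt : hit (S.erase v) (cls U r v) < hit S (cls U r v) := by
    by_contra hcon
    omega
  have h0 : hit (S.erase v) (cls U r v) = 0 ∧ hit S (cls U r v) = 1 := by
    unfold hit at hlt ⊢
    split_ifs at hlt ⊢ <;> simp_all
  refine ⟨J, r, ⟨hJ, ?_⟩, ?_, ?_⟩
  · omega
  · intro w hw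
    by_contra hwv
    have h2 := Finset.mem_inter.1 hw
    have hne : w ≠ v := by simpa using hwv
    have := hit_eq_one_of_mem (Finset.mem_erase.2 ⟨hne, h2.1⟩) h2.2
    omega
  · omega

/-- The roots of one colour can be placed. -/
lemma Covers.exists_placement_insert (hp : IsDemand p) (hA : ∀ e ∈ F, A e ⊆ U) {j : K}
    (hj : j ∉ T) (hn : ℓ j ≤ U.card) (hC : Covers U F A p ℓ (insert j T)) :
    ∃ S ⊆ U, S.card = ℓ j ∧ Covers U F A (fun X => p X - hit S X) ℓ T := by
  classical
  -- With roots everywhere, every class loses one unit of demand, which is the same as putting `j`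
  -- into `J`.
  have hU : Covers U F A (fun X => p X - hit U X) ℓ T := by
    intro J hJ r
    have h1 := hC (insert j J) (Finset.insert_subset_insert j hJ) r
    have hj' : j ∉ J := fun h => hj (hJ h)
    rw [Finset.insert_sdiff_insert, Finset.card_insert_of_notMem hj', Finset.sdiff_insert_of_notMem] at h1
    · refine le_trans (excess_mono fun X hX => ?_) h1
      obtain ⟨v, hv, rfl⟩ := Finset.mem_image.1 hX
      rw [hit_eq_one_of_mem hv (self_mem_cls hv)]
      push_cast
      omega
    · exact hj
  obtain ⟨S, hS, hmin⟩ := Finset.exists_min_image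
    (U.powerset.filter fun S => Covers U F A (fun X => p X - hit S X) ℓ T) Finset.card
    ⟨U, by simp [hU]⟩
  simp only [Finset.mem_filter, Finset.mem_powerset] at hS hmin
  obtain ⟨hSU, hCS⟩ := hS
  have hpS := hp.sub_hit S
  have hle : S.card ≤ ℓ j := by
    rcases S.eq_empty_or_nonempty with rfl | hne
    · simp
    have hbl : ∀ v ∈ S, ∃ J r, Tight U F A (fun X => p X - hit S X) ℓ T J r ∧
        S ∩ cls U r v ⊆ {v} ∧ (J.card : ℤ) ≤ p (cls U r v) - hit S (cls U r v) := by
      intro v hv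
      refine hCS.exists_tight_of_not_unplace (hSU hv) fun hcov => ?_
      have := hmin (S.erase v) ⟨(Finset.erase_subset _ _).trans hSU, hcov⟩
      exact absurd (Finset.card_erase_lt_of_mem hv) (not_lt.2 this)
    have hall : ∀ D ⊆ S, D.Nonempty → ∃ J r, Tight U F A (fun X => p X - hit S X) ℓ T J r ∧
        ∀ v ∈ D, S ∩ cls U r v ⊆ {v} ∧ (J.card : ℤ) ≤ p (cls U r v) - hit S (cls U r v) := by
      intro D hD hDne
      induction hDne using Finset.Nonempty.cons_induction with
      | singleton v =>
        obtain ⟨J, r, h1, h2⟩ := hbl v (hD (by simp))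
        exact ⟨J, r, h1, by simpa using h2⟩
      | cons v D hv hDne ih =>
        obtain ⟨J, r, h1, h2⟩ := hbl v (hD (by simp))
        obtain ⟨J', r', h1', h2'⟩ := ih fun x hx => hD (by simp [hx])
        obtain ⟨M, hM, hMJ, hMJ', -⟩ := hCS.tight_inf hpS hA h1 h1'
        -- Both properties survive the meet: classes shrink, the demand is antitone, and `M` is no
        -- larger than `J` and `J'`.
        refine ⟨M, _, hM, fun x hx => ?_⟩
        rcases Finset.mem_cons.1 hx with rfl | hx
        · have hs : cls U (r ⊓ r') x ⊆ cls U r x := cls_anti inf_le_left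
          have := hpS.anti _ _ hs
          exact ⟨(Finset.inter_subset_inter_left hs).trans h2.1, by omega⟩
        · have hs : cls U (r ⊓ r') x ⊆ cls U r' x := cls_anti inf_le_right
          have := hpS.anti _ _ hs
          have h3 := h2' x hx
          exact ⟨(Finset.inter_subset_inter_left hs).trans h3.1, by omega⟩
    obtain ⟨J, r, ⟨hJ, ht⟩, hcl⟩ := hall S subset_rfl hne
    have h1 := hC J (hJ.trans (Finset.subset_insert j T)) r
    rw [Finset.insert_sdiff_of_notMem _ fun h => hj (hJ h), Finset.sum_insert (by simp [hj])] at h1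
    have hinj : Set.InjOn (cls U r) S := by
      intro x hx y hy hxy
      have : x ∈ S ∩ cls U r y := by
        refine Finset.mem_inter.2 ⟨hx, ?_⟩
        rw [← hxy]
        exact self_mem_cls (hSU hx)
      simpa using (hcl y hy).1 this
    have himg : S.image (cls U r) ⊆ parts U r := Finset.image_subset_image hSU
    -- The roots lie in distinct classes, and in each of them forgetting the root raises the
    -- positive part by one. Against `h1`, where `j` lies outside `J` and contributes `ℓ j`, this
    -- bounds `S.card` by `ℓ j`.
    have hsum : (S.card : ℤ) ≤
        ∑ X ∈ parts U r, (max (p X - J.card) 0 - max (p X - hit S X - J.card) 0) := by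
      rw [← Finset.card_image_of_injOn hinj, Finset.card_eq_sum_ones]
      push_cast
      refine le_trans (Finset.sum_le_sum fun X hX => ?_)
        (Finset.sum_le_sum_of_subset_of_nonneg himg fun X _ _ => ?_)
      · obtain ⟨v, hv, rfl⟩ := Finset.mem_image.1 hX
        have := (hcl v hv).2
        have := hit_eq_one_of_mem hv (self_mem_cls (r := r) (hSU hv))
        omega
      · have : 0 ≤ hit S X := by
          unfold hit
          split_ifs <;> simp
        omega
    rw [Finset.sum_sub_distrib] at hsum
    simp only [excess] at h1 ht
    omega
  -- Further roots only lower the demand, so `S` can be padded to the exact size.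
  obtain ⟨S', hSS', hS'U, hcard⟩ := Finset.exists_subsuperset_card_eq hSU hle hn
  refine ⟨S', hS'U, hcard, fun J hJ r => le_trans (excess_mono fun X _ => ?_) (hCS J hJ r)⟩
  have := hit_mono hSS' (subset_refl X)
  omega

/-- The roots of all colours can be placed. -/
lemma Covers.exists_placement (hp : IsDemand p) (hA : ∀ e ∈ F, A e ⊆ U)
    (hn : ∀ i, ℓ i ≤ U.card) (hC : Covers U F A p ℓ T) :
    ∃ S : K → Finset V, (∀ i ∈ T, S i ⊆ U ∧ (S i).card = ℓ i) ∧
      IsDemand (fun X => p X - ∑ i ∈ T, hit (S i) X) ∧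
      Covers U F A (fun X => p X - ∑ i ∈ T, hit (S i) X) ℓ ∅ := by
  induction T using Finset.induction_on generalizing p with
  | empty => exact ⟨fun _ => ∅, by simp, by simpa using hp, by simpa using hC⟩
  | insert j T hj ih =>
    obtain ⟨R, hRU, hR, hCR⟩ := hC.exists_placement_insert hp hA hj (hn j)
    obtain ⟨S, hS, hd, hCS⟩ := ih (hp.sub_hit R) hCR
    have hsum : (fun X => p X - ∑ i ∈ insert j T, hit (Function.update S j R i) X) =
        fun X => p X - hit R X - ∑ i ∈ T, hit (S i) X := by
      funext X
      rw [Finset.sum_insert hj, Function.update_self, sub_sub]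
      congr 2
      refine Finset.sum_congr rfl fun i hi => ?_
      rw [Function.update_of_ne fun h : i = j => hj (h ▸ hi)]
    refine ⟨Function.update S j R, fun i hi => ?_, hsum ▸ hd, hsum ▸ hCS⟩
    by_cases hij : i = j
    · subst hij
      rw [Function.update_self]
      exact ⟨hRU, hR⟩
    · rw [Function.update_of_ne hij]
      exact hS i (Finset.mem_of_mem_insert_of_ne hi hij)

end Placement

/-! ### The count condition and the exchange step. -/

section Sparse

variable {V E K : Type*} [DecidableEq V] [DecidableEq E] [DecidableEq K] [Fintype K]
  {U : Finset V} {F : Finset E} {A : E → Finset V} {S : K → Finset V} {h : ℕ}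

/-- The colours having a root in `X`. -/
def touch (S : K → Finset V) (X : Finset V) : Finset K :=
  Finset.univ.filter fun i => (S i ∩ X).Nonempty

/-- The number of hyperedges contained in `X`. -/
def spanned (F : Finset E) (A : E → Finset V) (X : Finset V) : ℕ :=
  (F.filter fun e => A e ⊆ X).card

/-- The count condition for regular packings with exactly the root sets `S`, using all edges. -/
def Sparse (U : Finset V) (F : Finset E) (A : E → Finset V) (S : K → Finset V) (h : ℕ) : Prop :=
  (∀ X ⊆ U, X.Nonempty →
    spanned F A X + ∑ v ∈ X, (touch S {v}).card + (h - (touch S X).card) ≤ h * X.card) ∧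
  F.card + ∑ v ∈ U, (touch S {v}).card = h * U.card

lemma mem_touch {X : Finset V} {i : K} : i ∈ touch S X ↔ (S i ∩ X).Nonempty := by
  simp [touch]

lemma mem_touch_singleton {v : V} {i : K} : i ∈ touch S {v} ↔ v ∈ S i := by
  rw [mem_touch]
  constructor
  · rintro ⟨w, hw⟩
    rw [Finset.mem_inter, Finset.mem_singleton] at hw
    exact hw.2 ▸ hw.1
  · exact fun hv => ⟨v, by simp [hv]⟩

lemma touch_mono {X Y : Finset V} (hXY : X ⊆ Y) : touch S X ⊆ touch S Y := fun _ hi =>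
  mem_touch.2 ((mem_touch.1 hi).mono (Finset.inter_subset_inter_left hXY))

lemma touch_union (X Y : Finset V) : touch S (X ∪ Y) = touch S X ∪ touch S Y := by
  ext i
  simp only [mem_touch, Finset.mem_union, Finset.inter_union_distrib_left, Finset.union_nonempty]

lemma sum_hit (X : Finset V) : ∑ i, hit (S i) X = (touch S X).card := by
  simp [hit, touch]

lemma sum_touch_singleton (hS : ∀ i, S i ⊆ U) :
    ∑ v ∈ U, (touch S {v}).card = ∑ i, (S i).card := by
  have h1 : ∀ v, (touch S {v}).card = ∑ i, if v ∈ S i then 1 else 0 := by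
    intro v
    rw [← Finset.card_filter]
    congr 1
    ext i
    simp [mem_touch_singleton]
  simp only [h1]
  rw [Finset.sum_comm]
  refine Finset.sum_congr rfl fun i _ => ?_
  rw [← Finset.card_filter, Finset.filter_mem_eq_inter, Finset.inter_eq_right.2 (hS i)]

/-- The equivalence relation whose only nontrivial class is `X`. -/
def collapse (X : Finset V) : Setoid V where
  r u v := u = v ∨ (u ∈ X ∧ v ∈ X)
  iseqv :=
    { refl := fun _ => Or.inl rfl
      symm := by
        rintro u v (h | ⟨h1, h2⟩)
        · exact Or.inl h.symm
        · exact Or.inr ⟨h2, h1⟩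
      trans := by
        rintro u v w (rfl | ⟨h1, h2⟩) (rfl | ⟨h3, h4⟩)
        · exact Or.inl rfl
        · exact Or.inr ⟨h3, h4⟩
        · exact Or.inr ⟨h1, h2⟩
        · exact Or.inr ⟨h1, h4⟩ }

lemma collapse_rel {X : Finset V} {u v : V} : collapse X u v ↔ u = v ∨ (u ∈ X ∧ v ∈ X) := Iff.rfl

/-- Take the partition into `X` and singletons. Edges inside `X` do not cross it, so subtracting its
inequality from the exact total count leaves the bound on `X`. -/
lemma Covers.sparse {ℓ : K → ℕ} (hS : ∀ i, S i ⊆ U) (hℓ : ∀ i, (S i).card = ℓ i)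
    (hcard : F.card + ∑ i, ℓ i = h * U.card)
    (hC : Covers U F A (fun X => (h : ℤ) - ∑ i, hit (S i) X) ℓ ∅) : Sparse U F A S h := by
  classical
  have hsum : ∑ v ∈ U, (touch S {v}).card = ∑ i, ℓ i := by
    rw [sum_touch_singleton hS]
    exact Finset.sum_congr rfl fun i _ => hℓ i
  refine ⟨fun X hXU hX => ?_, by rw [hsum]; exact hcard⟩
  have h1 := hC ∅ subset_rfl (collapse X)
  simp only [sum_hit, Finset.card_empty, Nat.cast_zero, sub_zero, Finset.sdiff_empty,
    Finset.sum_empty, add_zero, excess] at h1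
  obtain ⟨x, hx⟩ := hX
  have c1 : cls U (collapse X) x = X := by
    ext w
    simp only [mem_cls, collapse_rel]
    constructor
    · rintro ⟨-, rfl | h⟩
      · exact hx
      · exact h.1
    · exact fun hw => ⟨hXU hw, Or.inr ⟨hw, hx⟩⟩
  have c2 : ∀ v ∈ U \ X, cls U (collapse X) v = {v} := by
    intro v hv
    rw [Finset.mem_sdiff] at hv
    ext w
    simp only [mem_cls, collapse_rel, Finset.mem_singleton]
    constructor
    · rintro ⟨-, h | h⟩
      · exact h
      · exact absurd h.2 hv.2
    · rintro rfl
      exact ⟨hv.1, Or.inl rfl⟩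
  have hni : X ∉ (U \ X).image fun v => ({v} : Finset V) := by
    intro hmem
    obtain ⟨v, hv, hvX⟩ := Finset.mem_image.1 hmem
    exact (Finset.mem_sdiff.1 hv).2 (hvX ▸ Finset.mem_singleton_self v)
  have hsub : insert X ((U \ X).image fun v => ({v} : Finset V)) ⊆ parts U (collapse X) := by
    refine Finset.insert_subset ?_ fun Y hY => ?_
    · have := cls_mem_parts (r := collapse X) (hXU hx)
      rwa [c1] at this
    · obtain ⟨v, hv, rfl⟩ := Finset.mem_image.1 hY
      rw [← c2 v hv]
      exact cls_mem_parts (Finset.mem_sdiff.1 hv).1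
  have h2 := Finset.sum_le_sum_of_subset_of_nonneg hsub
    (f := fun Y => max ((h : ℤ) - (touch S Y).card) 0) fun _ _ _ => le_max_right _ _
  rw [Finset.sum_insert hni, Finset.sum_image fun a _ b _ hab => Finset.singleton_injective hab]
    at h2
  have h3 : ∑ v ∈ U \ X, ((h : ℤ) - (touch S {v}).card) ≤
      ∑ v ∈ U \ X, max ((h : ℤ) - (touch S {v}).card) 0 :=
    Finset.sum_le_sum fun _ _ => le_max_left _ _
  rw [Finset.sum_sub_distrib, Finset.sum_const, nsmul_eq_mul, Finset.card_sdiff_of_subset hXU,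
    Nat.cast_sub (Finset.card_le_card hXU)] at h3
  have h4 : spanned F A X + crossing F A (collapse X) ≤ F.card := by
    unfold spanned crossing
    rw [← Finset.card_union_of_disjoint]
    · exact Finset.card_le_card (Finset.union_subset (Finset.filter_subset _ _)
        (Finset.filter_subset _ _))
    · refine Finset.disjoint_filter.2 fun e _ he hc => ?_
      obtain ⟨a, ha, b, hb, hab⟩ := hc
      exact hab (Or.inr ⟨he ha, he hb⟩)
  have h5 := Finset.sum_sdiff hXU (f := fun v => ((touch S {v}).card : ℤ))
  have h6 : ∑ v ∈ U, ((touch S {v}).card : ℤ) = ∑ i, (ℓ i : ℤ) := by exact_mod_cast hsum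
  have h7 : (F.card : ℤ) + ∑ i, (ℓ i : ℤ) = h * U.card := by exact_mod_cast hcard
  have h8 : (spanned F A X : ℤ) + crossing F A (collapse X) ≤ F.card := by exact_mod_cast h4
  have h9 : (spanned F A X : ℤ) + ∑ v ∈ X, ((touch S {v}).card : ℤ) +
      max ((h : ℤ) - (touch S X).card) 0 ≤ h * X.card := by
    linarith
  have h10 : (((h - (touch S X).card : ℕ)) : ℤ) = max ((h : ℤ) - (touch S X).card) 0 := by omega
  rw [← h10] at h9
  exact_mod_cast h9

lemma Sparse.touch_card_le (hSp : Sparse U F A S h) {v : V} (hv : v ∈ U) :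
    (touch S {v}).card ≤ h := by
  have := hSp.1 {v} (by simpa using hv) (by simp)
  simp only [Finset.sum_singleton, Finset.card_singleton, mul_one] at this
  omega

lemma spanned_uncross (X Y : Finset V) :
    spanned F A X + spanned F A Y ≤ spanned F A (X ∩ Y) + spanned F A (X ∪ Y) := by
  unfold spanned
  rw [← Finset.card_union_add_card_inter, add_comm, ← Finset.filter_and, ← Finset.filter_or]
  refine add_le_add (Finset.card_le_card fun e he => ?_) (Finset.card_le_card fun e he => ?_)
  · simp only [Finset.mem_filter] at he ⊢
    exact ⟨he.1, Finset.subset_inter he.2.1 he.2.2⟩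
  · simp only [Finset.mem_filter] at he ⊢
    exact ⟨he.1, he.2.elim (fun t => t.trans Finset.subset_union_left)
      fun t => t.trans Finset.subset_union_right⟩

/-- A minimal tight set whose colours are not all present at some unsaturated vertex contains an
edge `uv` with `v` unsaturated and a colour rooted at `u` but not at `v`. -/
lemma Sparse.exists_edge (hSp : Sparse U F A S h) (hA2 : ∀ e ∈ F, (A e).card = 2)
    {X : Finset V} (hXU : X ⊆ U)
    (hX : spanned F A X + ∑ v ∈ X, (touch S {v}).card + (h - (touch S X).card) = h * X.card)
    (hmin : ∀ Z ⊆ X, Z ≠ X →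
      spanned F A Z + ∑ v ∈ Z, (touch S {v}).card + (h - (touch S Z).card) = h * Z.card →
      ∀ v ∈ Z, (touch S {v}).card < h → touch S Z = touch S {v})
    {v₀ : V} (hv₀ : v₀ ∈ X) (hn : (touch S {v₀}).card < h) (hne : touch S X ≠ touch S {v₀}) :
    ∃ e ∈ F, ∃ u v i, A e = {u, v} ∧ u ≠ v ∧ u ∈ X ∧ v ∈ X ∧ u ∈ S i ∧ v ∉ S i ∧
      (touch S {v}).card < h := by
  classical
  obtain ⟨i, hiX, hiv⟩ : ∃ i ∈ touch S X, i ∉ touch S {v₀} := by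
    by_contra hcon
    push Not at hcon
    exact hne (Finset.Subset.antisymm hcon (touch_mono (by simpa using hv₀)))
  -- Any edge from `Y` to `Z` will do: its end in `Y` either is a root of `i` or is saturated, and
  -- then has some colour missing at the unsaturated end in `Z`.
  let Y := X.filter fun w => w ∈ S i ∨ h ≤ (touch S {w}).card
  let Z := X.filter fun w => ¬ (w ∈ S i ∨ h ≤ (touch S {w}).card)
  have hYX : Y ⊆ X := Finset.filter_subset _ _
  have hZX : Z ⊆ X := Finset.filter_subset _ _
  have hZv : v₀ ∈ Z := Finset.mem_filter.2 ⟨hv₀, fun t =>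
    t.elim (fun t => hiv (mem_touch_singleton.2 t)) (fun t => absurd hn (not_lt.2 t))⟩
  obtain ⟨w, hw⟩ := mem_touch.1 hiX
  rw [Finset.mem_inter] at hw
  have hYw : w ∈ Y := Finset.mem_filter.2 ⟨hw.2, Or.inl hw.1⟩
  have hwZ : w ∉ Z := fun t => (Finset.mem_filter.1 t).2 (Or.inl hw.1)
  by_cases hex : ∃ e ∈ F, ∃ u v, A e = {u, v} ∧ u ∈ Y ∧ v ∈ Z
  · obtain ⟨e, he, u, v, huv, hu, hv⟩ := hex
    obtain ⟨huX, hu'⟩ := Finset.mem_filter.1 hu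
    obtain ⟨hvX, hv'⟩ := Finset.mem_filter.1 hv
    push Not at hv'
    have hne' : u ≠ v := by
      rintro rfl
      exact (Finset.mem_filter.1 hv).2 hu'
    rcases hu' with hu' | hu'
    · exact ⟨e, he, u, v, i, huv, hne', huX, hvX, hu', hv'.1, hv'.2⟩
    · obtain ⟨j, hju, hjv⟩ := Finset.exists_mem_notMem_of_card_lt_card (hv'.2.trans_le hu')
      exact ⟨e, he, u, v, j, huv, hne', huX, hvX, mem_touch_singleton.1 hju,
        fun t => hjv (mem_touch_singleton.2 t), hv'.2⟩
  exfalso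
  push Not at hex
  have hsp : spanned F A X ≤ spanned F A Y + spanned F A Z := by
    unfold spanned
    refine le_trans (Finset.card_le_card fun e he => ?_) (Finset.card_union_le _ _)
    simp only [Finset.mem_filter, Finset.mem_union] at he ⊢
    obtain ⟨a, b, -, hab⟩ := Finset.card_eq_two.1 (hA2 e he.1)
    have ha : a ∈ X := he.2 (by simp [hab])
    have hb : b ∈ X := he.2 (by simp [hab])
    have n1 := hex e he.1 a b hab
    have n2 := hex e he.1 b a (by rw [hab, Finset.pair_comm])
    have hYZ : ∀ x ∈ X, x ∈ Y ∨ x ∈ Z := fun x hx => by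
      by_cases hx' : x ∈ S i ∨ h ≤ (touch S {x}).card
      · exact Or.inl (Finset.mem_filter.2 ⟨hx, hx'⟩)
      · exact Or.inr (Finset.mem_filter.2 ⟨hx, hx'⟩)
    rw [hab, Finset.insert_subset_iff, Finset.singleton_subset_iff, Finset.insert_subset_iff,
      Finset.singleton_subset_iff]
    rcases hYZ a ha with za | za <;> rcases hYZ b hb with zb | zb
    · exact Or.inl ⟨he.1, za, zb⟩
    · exact absurd zb (n1 za)
    · exact absurd za (n2 zb)
    · exact Or.inr ⟨he.1, za, zb⟩
  have hcd : Y.card + Z.card = X.card := Finset.card_filter_add_card_filter_not _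
  have hsm : ∑ v ∈ Y, (touch S {v}).card + ∑ v ∈ Z, (touch S {v}).card =
      ∑ v ∈ X, (touch S {v}).card := Finset.sum_filter_add_sum_filter_not _ _ _
  have b1 := hSp.1 Y (hYX.trans hXU) ⟨w, hYw⟩
  have b2 := hSp.1 Z (hZX.trans hXU) ⟨v₀, hZv⟩
  have hmul : h * Y.card + h * Z.card = h * X.card := by rw [← mul_add, hcd]
  have hZt := touch_mono (S := S) hZX
  have hZc := Finset.card_le_card hZt
  -- With no such edge the deficiencies `h - |touch|` of `Y` and `Z` sum to at most that of `X`. If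
  -- that is positive, `Z` has all colours of `X`, including `i`; if it is zero, `Z` is tight and
  -- minimality contradicts its zero deficiency.
  by_cases hXh : (touch S X).card < h
  · have hEq := Finset.eq_of_subset_of_card_le hZt (by omega)
    rw [← hEq, mem_touch] at hiX
    obtain ⟨z, hz⟩ := hiX
    rw [Finset.mem_inter] at hz
    exact (Finset.mem_filter.1 hz.2).2 (Or.inl hz.1)
  · have ht := hmin Z hZX (fun t => hwZ (t ▸ hw.2)) (by omega) v₀ hZv hn
    rw [ht] at hZc
    rw [ht] at b2
    omega

lemma touch_update {i : K} {v : V} (X : Finset V) :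
    touch (Function.update S i (insert v (S i))) X =
      if v ∈ X then insert i (touch S X) else touch S X := by
  ext j
  by_cases hj : j = i
  · subst hj
    by_cases hv : v ∈ X
    · simp [mem_touch, hv]
    · simp [mem_touch, hv]
  · split_ifs <;> simp [mem_touch, hj]

/-- Some edge can be deleted in exchange for adding a root at one of its end vertices. -/
lemma Sparse.exists_exchange (hSp : Sparse U F A S h) (hA : ∀ e ∈ F, A e ⊆ U)
    (hA2 : ∀ e ∈ F, (A e).card = 2) (hF : F.Nonempty) :
    ∃ e ∈ F, ∃ u v i, A e = {u, v} ∧ u ≠ v ∧ u ∈ S i ∧ v ∉ S i ∧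
      Sparse U (F.erase e) A (Function.update S i (insert v (S i))) h := by
  classical
  let Tt : Finset V → Prop := fun X =>
    spanned F A X + ∑ v ∈ X, (touch S {v}).card + (h - (touch S X).card) = h * X.card
  -- `U` satisfies `Q`: it is tight with at least `h` colours, and not all its vertices are
  -- saturated since `F` is nonempty. The edge is sought in a smallest set with this property.
  let Q : Finset V → Prop := fun X =>
    Tt X ∧ ∃ v ∈ X, (touch S {v}).card < h ∧ touch S X ≠ touch S {v}
  have hspU : spanned F A U = F.card := by
    unfold spanned
    rw [Finset.filter_true_of_mem hA]
  have hUne : U.Nonempty := by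
    obtain ⟨e, he⟩ := hF
    have := hA2 e he
    exact (Finset.card_pos.1 (by omega)).mono (hA e he)
  have hQU : Q U := by
    have h1 := hSp.1 U subset_rfl hUne
    have h2 := hSp.2
    refine ⟨by dsimp only [Tt]; omega, ?_⟩
    by_contra hcon
    push Not at hcon
    have : ∀ v ∈ U, h ≤ (touch S {v}).card := by
      intro v hv
      by_contra hlt
      have := hcon v hv (by omega)
      rw [this] at h1
      omega
    have h3 := Finset.card_nsmul_le_sum U (fun v => (touch S {v}).card) h this
    have h4 := hF.card_pos
    rw [smul_eq_mul, mul_comm] at h3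
    omega
  obtain ⟨X, hX, hXmin⟩ := Finset.exists_min_image (U.powerset.filter Q) Finset.card
    ⟨U, by simp [hQU]⟩
  simp only [Finset.mem_filter, Finset.mem_powerset] at hX hXmin
  obtain ⟨hXU, hXt, v₀, hv₀, hn₀, hne₀⟩ := hX
  have hmin : ∀ Z ⊆ X, Z ≠ X → Tt Z → ∀ v ∈ Z, (touch S {v}).card < h →
      touch S Z = touch S {v} := by
    intro Z hZX hne hZ v hv hvn
    by_contra hcon
    have := hXmin Z ⟨hZX.trans hXU, hZ, v, hv, hvn, hcon⟩
    exact hne (Finset.eq_of_subset_of_card_le hZX this)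
  obtain ⟨e, he, u, v, i, hAe, huv, hu, hv, hui, hvi, hvn⟩ :=
    hSp.exists_edge hA2 hXU hXt hmin hv₀ hn₀ hne₀
  refine ⟨e, he, u, v, i, hAe, huv, hui, hvi, ?_⟩
  have hvU := hXU hv
  have hiv : i ∉ touch S {v} := fun t => hvi (mem_touch_singleton.1 t)
  have hsingle : ∀ w, w ≠ v →
      (touch (Function.update S i (insert v (S i))) {w}).card = (touch S {w}).card := by
    intro w hw
    rw [touch_update, if_neg (by simpa using hw.symm)]
  have hsumv : ∀ Z : Finset V, v ∈ Z →
      ∑ w ∈ Z, (touch (Function.update S i (insert v (S i))) {w}).card =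
        ∑ w ∈ Z, (touch S {w}).card + 1 := by
    intro Z hZ
    rw [← Finset.sum_erase_add _ _ hZ, ← Finset.sum_erase_add Z (fun w => (touch S {w}).card) hZ, touch_update, if_pos (by simp), Finset.card_insert_of_notMem hiv, ← add_assoc]
    congr 2
    exact Finset.sum_congr rfl fun w hw => hsingle w (Finset.ne_of_mem_erase hw)
  have hsp1 : ∀ Z, spanned (F.erase e) A Z ≤ spanned F A Z := fun Z =>
    Finset.card_le_card (Finset.filter_subset_filter _ (Finset.erase_subset _ _))
  have hsp2 : ∀ Z, u ∈ Z → v ∈ Z → spanned (F.erase e) A Z + 1 = spanned F A Z := by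
    intro Z huZ hvZ
    unfold spanned
    rw [Finset.filter_erase, Finset.card_erase_add_one]
    exact Finset.mem_filter.2 ⟨he, by
      rw [hAe, Finset.insert_subset_iff, Finset.singleton_subset_iff]
      exact ⟨huZ, hvZ⟩⟩
  refine ⟨fun Z hZU hZ => ?_, ?_⟩
  · have b := hSp.1 Z hZU hZ
    have s1 := hsp1 Z
    by_cases hvZ : v ∈ Z
    · rw [hsumv Z hvZ, touch_update, if_pos hvZ]
      by_cases huZ : u ∈ Z
      · have s2 := hsp2 Z huZ hvZ
        rw [Finset.insert_eq_of_mem (mem_touch.2 ⟨u, Finset.mem_inter.2 ⟨hui, huZ⟩⟩)]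
        omega
      · by_contra hcon
        have hcard := Finset.card_insert_le i (touch S Z)
        have hZt : Tt Z := by
          dsimp only [Tt]
          have := Finset.card_le_card (Finset.subset_insert i (touch S Z))
          omega
        -- Otherwise the new colour lowers the deficiency of `Z` by one and pays for the new root.
        have hZi : i ∈ touch S Z ∨ h ≤ (touch S Z).card := by
          by_contra hno
          push Not at hno
          rw [Finset.card_insert_of_notMem hno.1] at hcon
          omega
        have hI : v ∈ X ∩ Z := Finset.mem_inter.2 ⟨hv, hvZ⟩
        have bI := hSp.1 (X ∩ Z) (Finset.inter_subset_left.trans hXU) ⟨v, hI⟩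
        have bU := hSp.1 (X ∪ Z) (Finset.union_subset hXU hZU) ⟨v, by simp [hv]⟩
        have su := spanned_uncross (F := F) (A := A) X Z
        have sc := Finset.card_union_add_card_inter X Z
        have ss := Finset.sum_union_inter (s₁ := X) (s₂ := Z)
          (f := fun w => (touch S {w}).card)
        have sm : h * (X ∪ Z).card + h * (X ∩ Z).card = h * X.card + h * Z.card := by
          rw [← mul_add, sc, mul_add]
        have mI1 := touch_mono (S := S) (Finset.inter_subset_left : X ∩ Z ⊆ X)
        have mI2 := touch_mono (S := S) (Finset.inter_subset_right : X ∩ Z ⊆ Z)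
        have iX : i ∈ touch S X := mem_touch.2 ⟨u, Finset.mem_inter.2 ⟨hui, hu⟩⟩
        have tU := Finset.card_union_add_card_inter (touch S X) (touch S Z)
        rw [← touch_union] at tU
        have mI := Finset.card_le_card (Finset.subset_inter mI1 mI2)
        have mU1 := Finset.card_le_card (touch_mono (S := S)
          (Finset.subset_union_left : X ⊆ X ∪ Z))
        have mU2 := Finset.card_le_card (touch_mono (S := S)
          (Finset.subset_union_right : Z ⊆ X ∪ Z))
        dsimp only [Tt] at hXt hZt
        -- The left side of the count condition is supermodular, so the intersection of tight sets
        -- containing `v` is tight. It misses `u`, hence is proper in `X`, and by minimality has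
        -- only the colours of `v`, not `i`.
        have hIt : Tt (X ∩ Z) := by
          dsimp only [Tt]
          omega
        have hIv := hmin (X ∩ Z) Finset.inter_subset_left
          (fun t => huZ (Finset.mem_inter.1 (t.symm.subset hu)).2) hIt v hI hvn
        dsimp only [Tt] at hIt
        have iI : i ∉ touch S (X ∩ Z) := hIv ▸ hiv
        have lX : (touch S (X ∩ Z)).card < (touch S X).card :=
          Finset.card_lt_card ⟨mI1, fun t => iI (t iX)⟩
        rw [← hIv] at hvn
        -- In both cases uncrossing the deficiencies of `X` and `Z` is strict, which contradicts
        -- tightness: `i` is either a common colour absent from the intersection, or `Z` has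
        -- deficiency zero.
        rcases hZi with hZi | hZi
        · have lZ : (touch S (X ∩ Z)).card < (touch S Z).card :=
            Finset.card_lt_card ⟨mI2, fun t => iI (t hZi)⟩
          have lI : (touch S (X ∩ Z)).card < (touch S X ∩ touch S Z).card :=
            Finset.card_lt_card ⟨Finset.subset_inter mI1 mI2,
              fun t => iI (t (Finset.mem_inter.2 ⟨iX, hZi⟩))⟩
          omega
        · omega
    · have hs : ∑ w ∈ Z, (touch (Function.update S i (insert v (S i))) {w}).card =
          ∑ w ∈ Z, (touch S {w}).card :=
        Finset.sum_congr rfl fun w hw => hsingle w fun t => hvZ (t ▸ hw)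
      rw [hs, touch_update, if_neg hvZ]
      omega
  · have h2 := hSp.2
    have h3 := Finset.card_erase_add_one he
    rw [hsumv U hvU]
    omega

end Sparse

end MultiHypergraph

/-! ### Directed paths, and joining two arborescences by an arc. -/

namespace MultiDigraph

variable {V E : Type*}

lemma isDipath_append (D : MultiDigraph V E) {x z : V} {l₁ l₂ : List E} :
    D.IsDipath x (l₁ ++ l₂) z ↔ ∃ y, D.IsDipath x l₁ y ∧ D.IsDipath y l₂ z := by
  induction l₁ generalizing x with
  | nil => simp [IsDipath]
  | cons a l ih =>
    simp only [List.cons_append, IsDipath, ih]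
    constructor
    · rintro ⟨h1, h2, y, h3, h4⟩
      exact ⟨y, ⟨h1, h2, h3⟩, h4⟩
    · rintro ⟨y, ⟨h1, h2, h3⟩, h4⟩
      exact ⟨h1, h2, y, h3, h4⟩

lemma IsDipath.eq_or_exists_head {D : MultiDigraph V E} {x y : V} {l : List E}
    (h : D.IsDipath x l y) : x = y ∨ ∃ a ∈ D.arcs, D.head a = y := by
  induction l generalizing x with
  | nil => exact Or.inl h
  | cons a l ih =>
    obtain ⟨h1, -, h3⟩ := h
    rcases ih h3 with h | h
    · exact Or.inr ⟨a, h1, h⟩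
    · exact Or.inr h

lemma IsDipath.mem_or_exists_enter {D : MultiDigraph V E} {X : Finset V} {x y : V} {l : List E}
    (h : D.IsDipath x l y) (hy : y ∈ X) :
    x ∈ X ∨ ∃ a ∈ D.arcs, D.head a ∈ X ∧ D.tail a ∉ X := by
  induction l generalizing x with
  | nil => exact Or.inl (h.symm ▸ hy)
  | cons a l ih =>
    obtain ⟨h1, h2, h3⟩ := h
    rcases ih h3 with h | h
    · by_cases hx : x ∈ X
      · exact Or.inl hx
      · exact Or.inr ⟨a, h1, h, h2.symm ▸ hx⟩
    · exact Or.inr h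

lemma IsDipath.subset_arcs {D : MultiDigraph V E} {x y : V} {l : List E}
    (h : D.IsDipath x l y) : ∀ a ∈ l, a ∈ D.arcs := by
  induction l generalizing x with
  | nil => simp
  | cons a l ih =>
    obtain ⟨h1, -, h3⟩ := h
    intro b hb
    rcases List.mem_cons.1 hb with rfl | hb
    · exact h1
    · exact ih h3 b hb

variable [DecidableEq E]

/-- Add the arc `e` from `u` to `v`. -/
def addArc (D : MultiDigraph V E) (e : E) {u v : V} (hu : u ∈ D.verts) (hv : v ∈ D.verts) :
    MultiDigraph V E where
  verts := D.verts
  arcs := insert e D.arcs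
  tail := Function.update D.tail e u
  head := Function.update D.head e v
  tail_mem a ha := by
    by_cases hae : a = e
    · subst hae
      rwa [Function.update_self]
    · rw [Function.update_of_ne hae]
      exact D.tail_mem a (Finset.mem_of_mem_insert_of_ne ha hae)
  head_mem a ha := by
    by_cases hae : a = e
    · subst hae
      rwa [Function.update_self]
    · rw [Function.update_of_ne hae]
      exact D.head_mem a (Finset.mem_of_mem_insert_of_ne ha hae)

lemma addArc_isDipath_iff (D : MultiDigraph V E) {e : E} {u v : V} (hu : u ∈ D.verts)
    (hv : v ∈ D.verts) {l : List E} (hl : e ∉ l) {x y : V} :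
    (D.addArc e hu hv).IsDipath x l y ↔ D.IsDipath x l y := by
  induction l generalizing x with
  | nil => rfl
  | cons a l ih =>
    have hae : a ≠ e := fun h => hl (by simp [h])
    have hl' : e ∉ l := fun h => hl (by simp [h])
    simp only [IsDipath, ih hl']
    simp only [addArc, Function.update_of_ne hae, Finset.mem_insert, hae, false_or]

/-- Adding an arc from a root to another root `v` of a branching removes `v` from the roots. -/
lemma IsBranching.addArc [DecidableEq V] {D : MultiDigraph V E} {S : Finset V} {e : E} {u v : V}
    (hD : D.IsBranching (insert v S)) (hu : u ∈ D.verts) (hv : v ∈ D.verts) (huS : u ∈ S)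
    (hvS : v ∉ S) (he : e ∉ D.arcs) : (D.addArc e hu hv).IsBranching S := by
  have hne : u ≠ v := fun h => hvS (h ▸ huS)
  refine ⟨(Finset.subset_insert v S).trans hD.1, fun w hw => ?_⟩
  have hroot : ∀ x ∈ insert v S, ∀ l, D.IsDipath x l u → x = u ∧ l = [] := by
    intro x hx l hl
    have := (hD.2 u hu).unique (y₁ := (x, l)) (y₂ := (u, [])) ⟨hx, hl⟩
      ⟨Finset.mem_insert_of_mem huS, rfl⟩
    exact Prod.mk.inj this
  have hsplit : ∀ {x y : V} {l₁ l₂ : List E}, (D.addArc e hu hv).IsDipath x (l₁ ++ e :: l₂) y →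
      (D.addArc e hu hv).IsDipath x l₁ u ∧ (D.addArc e hu hv).IsDipath v l₂ y := by
    intro x y l₁ l₂ h
    obtain ⟨z, h1, -, h2, h3⟩ := (isDipath_append _).1 h
    simp only [MultiDigraph.addArc, Function.update_self] at h2 h3
    exact ⟨h2 ▸ h1, h3⟩
  -- Since `u` is a root, its only old path is trivial. So a new path can use `e` only as its first
  -- arc, and only once.
  have hnew : ∀ x ∈ S, ∀ l, (D.addArc e hu hv).IsDipath x l w →
      D.IsDipath x l w ∨ ∃ l', x = u ∧ l = e :: l' ∧ D.IsDipath v l' w := by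
    intro x hx l hl
    by_cases hel : e ∈ l
    · obtain ⟨l₁, l₂, rfl, h1⟩ := List.eq_append_cons_of_mem hel
      obtain ⟨p1, p2⟩ := hsplit hl
      obtain ⟨rfl, rfl⟩ := hroot x (Finset.mem_insert_of_mem hx) l₁
        ((addArc_isDipath_iff D hu hv h1).1 p1)
      have h2 : e ∉ l₂ := by
        intro h2
        obtain ⟨l₃, l₄, rfl, h3⟩ := List.eq_append_cons_of_mem h2
        obtain ⟨q1, -⟩ := hsplit p2
        exact hne (hroot v (Finset.mem_insert_self v S) l₃
          ((addArc_isDipath_iff D hu hv h3).1 q1)).1.symm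
      exact Or.inr ⟨l₂, rfl, rfl, (addArc_isDipath_iff D hu hv h2).1 p2⟩
    · exact Or.inl ((addArc_isDipath_iff D hu hv hel).1 hl)
  obtain ⟨⟨s, l⟩, ⟨hs, hl⟩, huniq⟩ := hD.2 w hw
  dsimp only at hs hl
  have hel : e ∉ l := fun h => he (hl.subset_arcs e h)
  have hl' := (addArc_isDipath_iff D hu hv hel).2 hl
  by_cases hsv : s = v
  · subst hsv
    refine ⟨(u, e :: l), ⟨huS, ?_, ?_, ?_⟩, ?_⟩
    · simp [MultiDigraph.addArc]
    · simp [MultiDigraph.addArc]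
    · simpa [MultiDigraph.addArc] using hl'
    · rintro ⟨x, m⟩ ⟨hx, hm⟩
      rcases hnew x hx m hm with h | ⟨m', rfl, rfl, h⟩
      · have := huniq (x, m) ⟨Finset.mem_insert_of_mem hx, h⟩
        exact absurd ((Prod.mk.inj this).1 ▸ hx) hvS
      · have := huniq (s, m') ⟨Finset.mem_insert_self s S, h⟩
        rw [(Prod.mk.inj this).2]
  · refine ⟨(s, l), ⟨Finset.mem_of_mem_insert_of_ne hs hsv, hl'⟩, ?_⟩
    rintro ⟨x, m⟩ ⟨hx, hm⟩
    rcases hnew x hx m hm with h | ⟨m', rfl, rfl, h⟩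
    · exact huniq (x, m) ⟨Finset.mem_insert_of_mem hx, h⟩
    · have := huniq (v, m') ⟨Finset.mem_insert_self v S, h⟩
      exact absurd (Prod.mk.inj this).1.symm hsv

end MultiDigraph

/-! ### Cores of trimmed hyperbranchings. -/

namespace Dypergraph

variable {V E : Type*} [DecidableEq V]

lemma core_eq_of_isTrimming {D : Dypergraph V E} {A : MultiDigraph V E} {S : Finset V}
    (hA : D.IsTrimming A) (hS : A.IsBranching S) : D.core S = A.verts := by
  ext v
  simp only [core, Finset.mem_union, Finset.mem_filter]
  constructor
  · rintro (⟨-, h⟩ | h)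
    · obtain ⟨a, ha⟩ := Finset.card_pos.1 h
      obtain ⟨ha, hv, -⟩ := Finset.mem_filter.1 ha
      rw [Finset.mem_singleton] at hv
      rw [← hv, ← (hA.2 a ha).1]
      exact A.head_mem a (hA.1 ▸ ha)
    · exact hS.1 h
  · intro hv
    obtain ⟨⟨s, l⟩, ⟨hs, hl⟩, -⟩ := hS.2 v hv
    rcases hl.eq_or_exists_head with rfl | ⟨a, ha, rfl⟩
    · exact Or.inr hs
    · rw [hA.1] at ha
      rw [(hA.2 a ha).1]
      refine Or.inl ⟨D.head_mem a ha, Finset.card_pos.2 ⟨a, Finset.mem_filter.2 ⟨ha, by simp, ?_⟩⟩⟩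
      intro hsub
      obtain ⟨t, ht⟩ := D.tails_nonempty a ha
      have := Finset.mem_singleton.1 (hsub ht)
      exact D.head_notMem_tails a ha (this ▸ ht)

end Dypergraph

/-! ### Constructing the packing and proving the equivalence. -/

namespace MultiHypergraph

variable {V E K : Type*} [DecidableEq V] [DecidableEq E] [DecidableEq K] [Fintype K]
  {U : Finset V} {F : Finset E} {A : E → Finset V} {S : K → Finset V} {h : ℕ}

/-- A regular packing of branchings exists under the count condition. -/
lemma Sparse.exists_branchings (hSp : Sparse U F A S h) (hA : ∀ e ∈ F, A e ⊆ U)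
    (hA2 : ∀ e ∈ F, (A e).card = 2) (hU : U.Nonempty) (hS : ∀ i, S i ⊆ U) :
    ∃ D : K → MultiDigraph V E, (∀ i, (D i).verts ⊆ U ∧ (D i).arcs ⊆ F ∧ (D i).IsBranching (S i) ∧
      ∀ a ∈ (D i).arcs, (D i).tail a ∈ A a ∧ (D i).head a ∈ A a ∧ (D i).tail a ≠ (D i).head a) ∧
      (Pairwise fun i j => Disjoint (D i).arcs (D j).arcs) ∧
      ∀ v ∈ U, (Finset.univ.filter fun i => v ∈ (D i).verts).card = h := by
  induction hm : F.card generalizing F S with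
  | zero =>
    obtain rfl := Finset.card_eq_zero.1 hm
    -- A dummy value for the ends of arcs in digraphs without arcs.
    obtain ⟨v₀, -⟩ := hU
    refine ⟨fun i =>
      { verts := S i, arcs := ∅, tail := fun _ => v₀, head := fun _ => v₀,
        tail_mem := by simp, head_mem := by simp }, fun i => ⟨hS i, by simp, ⟨subset_rfl, ?_⟩,
        by simp⟩, fun i j _ => by simp, ?_⟩
    · intro u hu
      refine ⟨(u, []), ⟨hu, rfl⟩, ?_⟩
      rintro ⟨x, l⟩ ⟨-, hl⟩
      cases l with
      | nil =>
        have : x = u := hl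
        rw [this]
      | cons a l => exact absurd hl.1 (by simp)
    -- Each vertex is a root of at most `h` colours and the total is `h |U|`, so equality holds
    -- everywhere.
    · have h1 : ∀ v ∈ U, (touch S {v}).card = h := by
        refine (Finset.sum_eq_sum_iff_of_le fun v hv => hSp.touch_card_le hv).1 ?_
        have := hSp.2
        rw [Finset.sum_const, smul_eq_mul, mul_comm]
        simpa using this
      intro v hv
      rw [← h1 v hv]
      congr 1
      ext i
      simp [mem_touch_singleton]
  | succ m ih =>
    obtain ⟨e, he, u, v, i, hAe, huv, hui, hvi, hSp'⟩ :=
      hSp.exists_exchange hA hA2 (Finset.card_pos.1 (by omega))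
    have hvU : v ∈ U := hA e he (by simp [hAe])
    obtain ⟨D, hD, hdisj, hcount⟩ := ih hSp' (fun x hx => hA x (Finset.mem_of_mem_erase hx))
      (fun x hx => hA2 x (Finset.mem_of_mem_erase hx))
      (fun j => by
        by_cases hj : j = i
        · subst hj
          rw [Function.update_self]
          exact Finset.insert_subset hvU (hS j)
        · rw [Function.update_of_ne hj]
          exact hS j)
      (by rw [Finset.card_erase_of_mem he]; omega)
    have hDi := (hD i).2.2.1
    rw [Function.update_self] at hDi
    have hu : u ∈ (D i).verts := hDi.1 (Finset.mem_insert_of_mem hui)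
    have hv : v ∈ (D i).verts := hDi.1 (Finset.mem_insert_self v _)
    have hnot : ∀ j, e ∉ (D j).arcs := fun j hj => (Finset.mem_erase.1 ((hD j).2.1 hj)).1 rfl
    have hverts : ∀ j, (Function.update D i ((D i).addArc e hu hv) j).verts = (D j).verts := by
      intro j
      by_cases hj : j = i
      · subst hj
        rw [Function.update_self]
        rfl
      · rw [Function.update_of_ne hj]
    have hdisj' : ∀ j, j ≠ i → Disjoint (insert e (D i).arcs) (D j).arcs := fun j hj =>
      Finset.disjoint_insert_left.2 ⟨hnot j, hdisj hj.symm⟩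
    refine ⟨Function.update D i ((D i).addArc e hu hv), fun j => ⟨?_, ?_⟩, fun j j' hjj => ?_, ?_⟩
    · rw [hverts]
      exact (hD j).1
    · by_cases hj : j = i
      · subst hj
        rw [Function.update_self]
        refine ⟨Finset.insert_subset he ((hD j).2.1.trans (Finset.erase_subset _ _)),
          hDi.addArc hu hv hui hvi (hnot j), fun a ha => ?_⟩
        by_cases hae : a = e
        · subst hae
          simp [MultiDigraph.addArc, hAe, huv]
        · simp only [MultiDigraph.addArc, Function.update_of_ne hae]
          exact (hD j).2.2.2 a (Finset.mem_of_mem_insert_of_ne ha hae)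
      · rw [Function.update_of_ne hj]
        have := (hD j).2.2.1
        rw [Function.update_of_ne hj] at this
        exact ⟨(hD j).2.1.trans (Finset.erase_subset _ _), this, (hD j).2.2.2⟩
    · dsimp only
      by_cases hj : j = i
      · subst hj
        rw [Function.update_self, Function.update_of_ne hjj.symm]
        exact hdisj' j' hjj.symm
      · rw [Function.update_of_ne hj]
        by_cases hj' : j' = i
        · subst hj'
          rw [Function.update_self]
          exact (hdisj' j hj).symm
        · rw [Function.update_of_ne hj']
          exact hdisj hjj
    · intro w hw
      simp only [hverts]
      exact hcount w hw

section Main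

variable {V E : Type*} [DecidableEq V]

/-- The partition condition, read off for equivalence relations. -/
lemma covers_of_partition [DecidableEq E] (G : MultiHypergraph V E) {h k : ℕ} {ℓ : Fin k → ℕ}
    (hP : ∀ P : Finpartition G.verts,
      h * P.parts.card ≤ (∑ i, min (ℓ i) P.parts.card) + G.numEntering P) :
    Covers G.verts G.edges G.ends (fun _ => (h : ℤ)) ℓ Finset.univ := by
  classical
  intro J _ r
  let P : Finpartition G.verts := Finpartition.ofExistsUnique (parts G.verts r)
    (fun X hX => by
      obtain ⟨v, -, rfl⟩ := Finset.mem_image.1 hX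
      exact fun w hw => (mem_cls.1 hw).1)
    (fun v hv => ⟨cls G.verts r v, ⟨cls_mem_parts hv, self_mem_cls hv⟩,
      fun X hX => eq_cls_of_mem hX.1 hX.2⟩)
    (fun hmem => by
      obtain ⟨v, hv, h0⟩ := Finset.mem_image.1 hmem
      exact Finset.notMem_empty v (h0 ▸ self_mem_cls hv))
  have hparts : P.parts = parts G.verts r := rfl
  have h1 := hP P
  have h2 : G.numEntering P ≤ crossing G.edges G.ends r := by
    unfold numEntering crossing
    refine Finset.card_le_card fun e he => ?_
    obtain ⟨he, X, hX, ⟨x, hx⟩, ⟨y, hy⟩⟩ := Finset.mem_filter.1 he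
    rw [Finset.mem_inter] at hx
    rw [Finset.mem_sdiff] at hy
    refine Finset.mem_filter.2 ⟨he, y, hy.1, x, hx.1, fun hr => hy.2 ?_⟩
    rw [hparts] at hX
    rw [eq_cls_of_mem hX hx.2]
    exact mem_cls.2 ⟨G.ends_subset e he hy.1, hr⟩
  -- Each minimum is bounded by the term that `J` selects.
  have h3 : ∑ i, min (ℓ i) P.parts.card ≤ ∑ i ∈ Finset.univ \ J, ℓ i + J.card * P.parts.card := by
    rw [← Finset.sum_sdiff (Finset.subset_univ J)]
    refine add_le_add (Finset.sum_le_sum fun i _ => min_le_left _ _) ?_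
    exact Finset.sum_le_card_nsmul J _ _ fun i _ => min_le_right _ _
  rw [hparts] at h1 h3
  rw [excess_const]
  have h4 : (h : ℤ) * (parts G.verts r).card ≤ (∑ i ∈ Finset.univ \ J, (ℓ i : ℤ)) +
      J.card * (parts G.verts r).card + crossing G.edges G.ends r := by
    have := h1.trans (add_le_add h3 h2)
    exact_mod_cast this
  have h5 : (0 : ℤ) ≤ ∑ i ∈ Finset.univ \ J, (ℓ i : ℤ) := Finset.sum_nonneg fun _ _ => by positivity
  rcases le_total ((h : ℤ) - J.card) 0 with h6 | h6
  · rw [max_eq_right h6]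
    omega
  · rw [max_eq_left h6]
    linarith

lemma exists_regularPacking (G : MultiHypergraph V E) {h k : ℕ} (hk : 0 < k) {ℓ : Fin k → ℕ}
    (hℓ : ∀ i, 0 < ℓ i) (hn : ∀ i, ℓ i ≤ G.verts.card) (hs : ∑ i, ℓ i ≤ h * G.verts.card)
    (hP : ∀ P : Finpartition G.verts,
      h * P.parts.card ≤ (∑ i, min (ℓ i) P.parts.card) + G.numEntering P) :
    ∃ (H : Fin k → MultiHypergraph V E) (S : Fin k → Finset V),
      G.IsRegularPacking h H S ∧ ∀ i, (S i).card = ℓ i := by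
  classical
  have hU : G.verts.Nonempty := Finset.card_pos.1 ((hℓ ⟨0, hk⟩).trans_le (hn ⟨0, hk⟩))
  obtain ⟨F, hF, hC, hcard⟩ := exists_subset_covers_card_eq h G.ends_subset hn hs
    (covers_of_partition G hP)
  have hFU : ∀ e ∈ F, G.ends e ⊆ G.verts := fun e he => G.ends_subset e (hF he)
  obtain ⟨S, hS, hd, hCS⟩ := hC.exists_placement (isDemand_const (h : ℤ)) hFU hn
  obtain ⟨B, hB, hB2, hCB⟩ := hCS.exists_trimming hd hFU
    fun e he => G.two_le_card_ends e (hF he)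
  have hSU : ∀ i, S i ⊆ G.verts := fun i => (hS i (Finset.mem_univ i)).1
  have hSc : ∀ i, (S i).card = ℓ i := fun i => (hS i (Finset.mem_univ i)).2
  obtain ⟨D, hD, hdisj, hcount⟩ := (hCB.sparse hSU hSc hcard).exists_branchings
    (fun e he => (hB e he).trans (hFU e he)) hB2 hU hSU
  have hends : ∀ i, ∀ a ∈ (D i).arcs, (D i).tail a ∈ G.ends a ∧ (D i).head a ∈ G.ends a ∧
      (D i).tail a ≠ (D i).head a := fun i a ha =>
    have haF := (hD i).2.1 ha
    have h1 := (hD i).2.2.2 a ha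
    ⟨hB a haF h1.1, hB a haF h1.2.1, h1.2.2⟩
  have hedge : ∀ i, (D i).arcs ⊆ G.edges := fun i => (hD i).2.1.trans hF
  let H : Fin k → MultiHypergraph V E := fun i =>
    { verts := G.verts
      edges := (D i).arcs
      ends := G.ends
      ends_subset := fun e he => G.ends_subset e (hedge i he)
      two_le_card_ends := fun e he => G.two_le_card_ends e (hedge i he) }
  let O : Fin k → Dypergraph V E := fun i =>
    { verts := G.verts
      hyperarcs := (D i).arcs
      tails := fun a => (G.ends a).erase ((D i).head a)
      head := (D i).head
      tails_subset := fun a ha => (Finset.erase_subset _ _).trans (G.ends_subset a (hedge i ha))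
      head_mem := fun a ha => G.ends_subset a (hedge i ha) (hends i a ha).2.1
      tails_nonempty := fun a ha =>
        ⟨(D i).tail a, Finset.mem_erase.2 ⟨(hends i a ha).2.2, (hends i a ha).1⟩⟩
      head_notMem_tails := fun a _ => Finset.notMem_erase _ _ }
  have htrim : ∀ i, (O i).IsTrimming (D i) := fun i =>
    ⟨rfl, fun a ha => ⟨rfl, Finset.mem_erase.2 ⟨(hends i a ha).2.2, (hends i a ha).1⟩⟩⟩
  have hcore : ∀ i, (O i).core (S i) = (D i).verts := fun i =>
    Dypergraph.core_eq_of_isTrimming (htrim i) (hD i).2.2.1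
  have hor : ∀ i, (H i).IsOrientation (O i) ∧ (O i).IsHyperbranching (S i) := fun i =>
    ⟨⟨rfl, rfl, fun e he => ⟨(hends i e he).2.1, rfl⟩⟩,
      hSU i, D i, (hcore i).symm, htrim i, (hD i).2.2.1⟩
  refine ⟨H, S, ⟨⟨fun i => ⟨⟨subset_rfl, hedge i, fun _ _ => rfl⟩, O i, hor i⟩, hdisj⟩,
    O, hor, fun v hv => ?_⟩, hSc⟩
  simp only [hcore]
  exact hcount v hv

lemma IsRegularPacking.roots_subset {G : MultiHypergraph V E} {h k : ℕ}
    {H : Fin k → MultiHypergraph V E} {S : Fin k → Finset V} (hR : G.IsRegularPacking h H S)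
    (i : Fin k) : S i ⊆ G.verts := by
  obtain ⟨⟨hsub, -⟩, D, hD, -⟩ := hR
  exact (hD i).2.1.trans ((hD i).1.1.subset.trans (hsub i).1.1)

lemma IsRegularPacking.sum_card_le {G : MultiHypergraph V E} {h k : ℕ}
    {H : Fin k → MultiHypergraph V E} {S : Fin k → Finset V} (hR : G.IsRegularPacking h H S) :
    ∑ i, (S i).card ≤ h * G.verts.card := by
  rw [← sum_touch_singleton hR.roots_subset]
  obtain ⟨-, D, -, hcount⟩ := hR
  have := Finset.sum_le_card_nsmul G.verts (fun v => (touch S {v}).card) h fun v hv => by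
    rw [← hcount v hv]
    refine Finset.card_le_card fun i hi => ?_
    exact Finset.mem_filter.2 ⟨Finset.mem_univ i,
      Finset.mem_union_right _ (mem_touch_singleton.1 hi)⟩
  rwa [smul_eq_mul, mul_comm] at this

/-- Double counting: the parts met by `S i` are images of its elements under `P.part`. -/
lemma sum_touch_parts_le {U : Finset V} {k : ℕ} (S : Fin k → Finset V) (P : Finpartition U) :
    ∑ X ∈ P.parts, (touch S X).card ≤ ∑ i, min (S i).card P.parts.card := by
  simp only [touch, Finset.card_filter]
  rw [Finset.sum_comm]
  refine Finset.sum_le_sum fun i _ => ?_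
  rw [← Finset.card_filter]
  refine le_min ?_ (Finset.card_filter_le _ _)
  refine le_trans (Finset.card_le_card fun X hX => ?_) (Finset.card_image_le (f := P.part))
  obtain ⟨hX, v, hv⟩ := Finset.mem_filter.1 hX
  rw [Finset.mem_inter] at hv
  exact Finset.mem_image.2 ⟨v, hv.1, P.part_eq_of_mem hX hv.2⟩

lemma IsRegularPacking.partition_le {G : MultiHypergraph V E} {h k : ℕ}
    {H : Fin k → MultiHypergraph V E} {S : Fin k → Finset V} (hR : G.IsRegularPacking h H S)
    (P : Finpartition G.verts) :
    h * P.parts.card ≤ (∑ i, min (S i).card P.parts.card) + G.numEntering P := by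
  classical
  obtain ⟨⟨hsub, hdisj⟩, D, hD, hcount⟩ := hR
  -- Entering is taken in the oriented sense, so that a hyperedge enters at most one part.
  let enter : Finset V → Finset E := fun X => G.edges.filter fun e =>
    ∃ i, e ∈ (H i).edges ∧ (D i).head e ∈ X ∧ ¬ G.ends e ⊆ X
  have hX : ∀ X ∈ P.parts, h ≤ (touch S X).card + (enter X).card := by
    intro X hX
    obtain ⟨v, hv⟩ := P.nonempty_of_mem_parts hX
    rw [← hcount v (P.le hX hv)]
    have key : ∀ i, v ∈ (D i).core (S i) → i ∈ touch S X ∨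
        ∃ e ∈ (H i).edges, (D i).head e ∈ X ∧ ¬ G.ends e ⊆ X := by
      intro i hi
      obtain ⟨⟨-, hor1, hor2⟩, -, A, hAv, hAt, hAb⟩ := hD i
      obtain ⟨⟨s, l⟩, ⟨hs, hl⟩, -⟩ := hAb.2 v (hAv ▸ hi)
      rcases hl.mem_or_exists_enter hv with h1 | ⟨a, ha, h1, h2⟩
      · exact Or.inl (mem_touch.2 ⟨s, Finset.mem_inter.2 ⟨hs, h1⟩⟩)
      · rw [hAt.1] at ha
        obtain ⟨h3, h4⟩ := hAt.2 a ha
        rw [hor1] at ha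
        rw [(hor2 a ha).2, (hsub i).1.2.2 a ha] at h4
        exact Or.inr ⟨a, ha, h3 ▸ h1, fun h5 => h2 (h5 (Finset.mem_of_mem_erase h4))⟩
    let J := Finset.univ.filter fun i => ∃ e ∈ (H i).edges, (D i).head e ∈ X ∧ ¬ G.ends e ⊆ X
    have hJc : J.card ≤ (enter X).card := by
      refine Finset.card_le_card_of_forall_subsingleton (fun i e => e ∈ (H i).edges)
        (fun i hi => ?_) fun e _ i hi j hj => ?_
      · obtain ⟨e, h1, h2, h3⟩ := (Finset.mem_filter.1 hi).2
        exact ⟨e, Finset.mem_filter.2 ⟨(hsub i).1.2.1 h1, i, h1, h2, h3⟩, h1⟩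
      · by_contra hne
        exact Finset.disjoint_left.1 (hdisj hne) hi.2 hj.2
    refine le_trans (Finset.card_le_card fun i hi => ?_)
      ((Finset.card_union_le (touch S X) J).trans (Nat.add_le_add_left hJc _))
    rw [Finset.mem_union]
    exact (key i (Finset.mem_filter.1 hi).2).imp_right fun t =>
      Finset.mem_filter.2 ⟨Finset.mem_univ i, t⟩
  have hE : ∑ X ∈ P.parts, (enter X).card ≤ G.numEntering P := by
    rw [← Finset.card_biUnion]
    · refine Finset.card_le_card fun e he => ?_
      obtain ⟨X, hX, he⟩ := Finset.mem_biUnion.1 he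
      obtain ⟨he, i, hi, h1, h2⟩ := Finset.mem_filter.1 he
      have h3 := ((hD i).1.2.2 e hi).1
      rw [(hsub i).1.2.2 e hi] at h3
      exact Finset.mem_filter.2 ⟨he, X, hX, ⟨_, Finset.mem_inter.2 ⟨h3, h1⟩⟩,
        Finset.sdiff_nonempty.2 h2⟩
    · intro X hX Y hY hXY
      refine Finset.disjoint_left.2 fun e he he' => ?_
      obtain ⟨-, i, hi, h1, -⟩ := Finset.mem_filter.1 he
      obtain ⟨-, j, hj, h2, -⟩ := Finset.mem_filter.1 he'
      have hij : i = j := by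
        by_contra hne
        exact Finset.disjoint_left.1 (hdisj hne) hi hj
      subst hij
      exact Finset.disjoint_left.1 (P.disjoint hX hY hXY) h1 h2
  have h1 := Finset.card_nsmul_le_sum P.parts (fun X => (touch S X).card + (enter X).card) h hX
  rw [Finset.sum_add_distrib, smul_eq_mul, mul_comm] at h1
  exact h1.trans (add_le_add (sum_touch_parts_le S P) hE)

end Main

end MultiHypergraph

theorem mainTheorem7 {V E : Type*} [DecidableEq V] (G : MultiHypergraph V E)
    (h k : ℕ) (hh : 0 < h) (hk : 0 < k) (ℓ : Fin k → ℕ) (hℓ : ∀ i, 0 < ℓ i) :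
    (∃ (H : Fin k → MultiHypergraph V E) (S : Fin k → Finset V),
        G.IsRegularPacking h H S ∧ ∀ i, (S i).card = ℓ i) ↔
      (∀ i, ℓ i ≤ G.verts.card) ∧
      ∑ i, ℓ i ≤ h * G.verts.card ∧
      ∀ P : Finpartition G.verts,
        h * P.parts.card ≤ (∑ i, min (ℓ i) P.parts.card) + G.numEntering P := by
  constructor
  · rintro ⟨H, S, hR, hS⟩
    simp only [← hS]
    exact ⟨fun i => Finset.card_le_card (hR.roots_subset i), hR.sum_card_le, hR.partition_le⟩
  · rintro ⟨hn, hs, hP⟩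
    exact MultiHypergraph.exists_regularPacking G hk hℓ hn hs hP
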